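/- Let $S^2$ be the unit sphere in Euclidean 3-space with spherical distance $|xy|=\arccos\langle x,y\rangle$. The disk of radius $\rho$ with center $c$ is $\{p\in S^2: |cp|\le\rho\}$; a hemisphere is a disk of radius $\pi/2$. A convex body is a closed set $C\subset S^2$ with non-empty interior that contains no pair of antipodes and contains, with any two of its points, the shorter great-circle arc joining them. A hemisphere $K$ supports $C$ if $C\subset K$ and $\mathrm{bd}(C)\cap\mathrm{bd}(K)\neq\emptyset$. For two different, non-opposite hemispheres $G,H$ the thickness of the lune $G\cap H$ is the spherical distance between the centers of the two semicircles bounding it. For a hemisphere $K$ supporting $C$, $\mathrm{width}_K(C)$ is the minimum thickness of the lunes $K\cap K'$ over the hemispheres $K'$ supporting $C$ (different from $K$ and not opposite to it), and the thickness $\Delta(C)$ is the minimum of $\mathrm{width}_K(C)$ over all hemispheres $K$ supporting $C$. A convex body $R$ is reduced if $\Delta(Z)<\Delta(R)$ for every convex body $Z\subset R$ with $Z\ne R$. **Theorem.** Every reduced convex body $R\subset S^2$ with $\Delta(R)\le\frac{\pi}{2}$ is contained in a disk of radius $\arctan\left(\sqrt2\,\tan\frac{\Delta(R)}{2}\right)$.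 This estimate cannot be improved: for every $\delta\in(0,\frac{\pi}{2}]$, each quarter of a disk of radius $\delta$ (one of the four parts into which the disk is cut by two perpendicular great circles through its center) is a reduced convex body of thickness $\delta$, and it is contained in no disk of radius smaller than $\arctan\left(\sqrt2\,\tan\frac{\delta}{2}\right)$. -/

import Mathlib

namespace Spherical

open Real Set

/-- Euclidean 3-space. -/
abbrev E3 : Type := EuclideanSpace ℝ (Fin 3)

/-- The unit sphere `S²`, with the topology induced from Euclidean 3-space. -/
abbrev S2 : Type := Metric.sphere (0 : E3) 1

/-- Spherical distance: the length of the shorter great-circle arc, `π` for antipodes. -/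
noncomputable def sdist (x y : S2) : ℝ :=
  InnerProductGeometry.angle (x : E3) (y : E3)

/-- The spherical disk of radius `ρ` with center `c`. -/
def disk (c : S2) (ρ : ℝ) : Set S2 := {p | sdist c p ≤ ρ}

/-- The hemisphere `H(m)` with center `m`. -/
noncomputable def hemisphere (m : S2) : Set S2 := disk m (π / 2)

/-- The arc joining `a` and `b`: the points of the sphere in the cone spanned by `a` and `b`.
For `a`, `b` not antipodal it is the shorter part of the great circle through `a` and `b`
(and it is `{a}` when `a = b`). -/
def arc (a b : S2) : Set S2 :=
  {p | ∃ s t : ℝ, 0 ≤ s ∧ 0 ≤ t ∧ (p : E3) = s • (a : E3) + t • (b : E3)}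

/-- Spherical convexity: no pair of antipodes, and closed under taking arcs. -/
def IsConvex (C : Set S2) : Prop :=
  (∀ a ∈ C, -a ∉ C) ∧ ∀ a ∈ C, ∀ b ∈ C, arc a b ⊆ C

/-- A convex body: a closed convex set with non-empty interior. -/
def IsConvexBody (C : Set S2) : Prop :=
  IsClosed C ∧ IsConvex C ∧ (interior C).Nonempty

/-- The hemisphere with center `m` supports `C`: it contains `C` and the boundaries meet. -/
def Supports (m : S2) (C : Set S2) : Prop :=
  C ⊆ hemisphere m ∧ (frontier C ∩ frontier (hemisphere m)).Nonempty

/-- The center of the semicircle `H(g)/H(h)` (the part of the bounding great circle of `H(g)`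
that lies in `H(h)`): the normalized orthogonal projection of `h` to the plane `g^⊥`,
see `semicircleCenter_spec`. -/
noncomputable def semicircleCenter (g h : S2) : E3 :=
  ‖(h : E3) - inner ℝ (g : E3) (h : E3) • (g : E3)‖⁻¹ •
    ((h : E3) - inner ℝ (g : E3) (h : E3) • (g : E3))

/-- The thickness of the lune `H(g) ∩ H(h)`, for `h` different from `g` and `-g`: the spherical
distance of the centers of the two semicircles that bound it. -/
noncomputable def luneThickness (g h : S2) : ℝ :=
  InnerProductGeometry.angle (semicircleCenter g h) (semicircleCenter h g)

/-- The width of `C` determined by the hemisphere `H(k)`: the least thickness of a lune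
`H(k) ∩ H(m)` with `H(m)` supporting `C`. -/
noncomputable def width (k : S2) (C : Set S2) : ℝ :=
  sInf {w | ∃ m : S2, Supports m C ∧ m ≠ k ∧ m ≠ -k ∧ w = luneThickness k m}

/-- The thickness `Δ(C)`: the least width of `C` over all supporting hemispheres. -/
noncomputable def thickness (C : Set S2) : ℝ :=
  sInf {w | ∃ k : S2, Supports k C ∧ w = width k C}

/-- A reduced body: a convex body all of whose proper convex sub-bodies have smaller thickness. -/
def IsReduced (R : Set S2) : Prop :=
  IsConvexBody R ∧ ∀ K : Set S2, IsConvexBody K → K ⊆ R → K ≠ R → thickness K < thickness R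

/-- The part of the disk of radius `δ` with center `o` cut off by the hemispheres `H(u)` and
`H(v)`. When `o`, `u`, `v` are pairwise orthogonal, the bounding great circles of these
hemispheres pass through `o` and are perpendicular, and this is a quarter of the disk. -/
def quarterDisk (o u v : S2) (δ : ℝ) : Set S2 :=
  disk o δ ∩ hemisphere u ∩ hemisphere v

theorem mem_hemisphere (m p : S2) : p ∈ hemisphere m ↔ 0 ≤ inner ℝ (m : E3) (p : E3) := by
  have hm : ‖(m : E3)‖ = 1 := by simp
  simp [hemisphere, disk, sdist, InnerProductGeometry.angle, Real.arccos_le_pi_div_two, hm]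

/-- `semicircleCenter g h` is a point of the sphere on the bounding great circle of `H(g)`, and
the points of this great circle in `H(h)` are those at distance at most `π / 2` from it. -/
theorem semicircleCenter_spec (g h : S2) (h₁ : h ≠ g) (h₂ : h ≠ -g) :
    ‖semicircleCenter g h‖ = 1 ∧ inner ℝ (g : E3) (semicircleCenter g h) = 0 ∧
      ∀ p : S2, inner ℝ (g : E3) (p : E3) = 0 →
        (p ∈ hemisphere h ↔
          InnerProductGeometry.angle (semicircleCenter g h) (p : E3) ≤ π / 2) := by
  have hg : ‖(g : E3)‖ = 1 := by simp
  have hh : ‖(h : E3)‖ = 1 := by simp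
  have hne : (h : E3) - inner ℝ (g : E3) (h : E3) • (g : E3) ≠ 0 := by
    intro h0
    have e : (h : E3) = inner ℝ (g : E3) (h : E3) • (g : E3) := sub_eq_zero.mp h0
    have ha : |inner ℝ (g : E3) (h : E3)| = 1 := by
      have := congrArg norm e
      rw [norm_smul, hh, hg] at this
      simpa using this.symm
    rcases eq_or_eq_neg_of_abs_eq ha with h' | h'
    · exact h₁ (Subtype.ext (by rw [e, h']; simp))
    · exact h₂ (Subtype.ext (by rw [e, h']; simp))
  have hpos : 0 < ‖(h : E3) - inner ℝ (g : E3) (h : E3) • (g : E3)‖ := norm_pos_iff.mpr hne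
  refine ⟨?_, ?_, ?_⟩
  · rw [semicircleCenter, norm_smul, norm_inv, norm_norm, inv_mul_cancel₀ hpos.ne']
  · rw [semicircleCenter, inner_smul_right, inner_sub_right, inner_smul_right,
      real_inner_self_eq_norm_sq, hg]
    simp
  · intro p hp
    rw [mem_hemisphere, semicircleCenter,
      InnerProductGeometry.angle_smul_left_of_pos _ _ (inv_pos.mpr hpos),
      InnerProductGeometry.angle, Real.arccos_le_pi_div_two, inner_sub_left, inner_smul_left, hp]
    have hp1 : ‖(p : E3)‖ = 1 := by simp
    rw [hp1, mul_one, mul_zero, sub_zero, div_nonneg_iff]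
    constructor
    · intro h; exact Or.inl ⟨h, hpos.le⟩
    · rintro (h | h)
      · exact h.1
      · exact absurd h.2 (not_le.mpr hpos)

end Spherical

/-! The polar of a body, the set of centers of the hemispheres containing it, carries the argument.
The lune of H(g) and H(h) has thickness π minus the distance from g to h (`luneThickness_eq`), so Δ
is π minus the diameter of the polar (`IsConvexBody.exists_diametral`). Varying a diametral pair
shows that, for Δ ≤ π/2, the semicircle centers of a thinnest lune lie in the body
(`IsConvexBody.center_mem`).

Let R be reduced with Δ ≤ π/2, and let c = cos Δ, s = sin Δ. Cutting off smaller and smaller pieces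
at an exposed point e and passing to the limit gives a lune of thickness Δ that contains R, has e as
one semicircle center, and has its other semicircle center in R
(`IsReduced.exists_lune_of_exposed`). The point x of least norm in the Euclidean hull of R yields a
disk of radius arccos ‖x‖ around R, and x is a convex combination of three points of R that are
exposed unless ‖x‖ = 1. Their three lunes contain each other's semicircle centers. This forces the
inner products of the three points to be at least c² (`Linked.sq_le_inner`) and the sines of the
heights of their triangle to be at most s (`vol_sq_le_of_linked`). From these two facts
`circumradius_form_le` deduces ‖x‖² ≥ (1+c)/(3-c), the squared cosine of the required radius; the
extremal triangle is the right triangle with both legs Δ, spanned by a quarter of a disk.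

For the quarter, the coordinates of polar points are controlled well enough to find the diameter of
the polar (`IsFrame.thickness_quarterDisk`). A hemisphere containing a body in its interior takes no
part in a thinnest lune; hence a sub-body of thickness at least δ must contain the center and the
whole circular arc, and therefore everything. The center and the two ends of the arc already force
the radius. -/

namespace Spherical

open Real Set
open scoped InnerProductSpace

/-! ### Unit vectors -/

/-- The point of the sphere in the direction of a nonzero vector. -/
noncomputable def unitVec (x : E3) (hx : x ≠ 0) : S2 :=
  ⟨‖x‖⁻¹ • x, by simp [norm_smul, hx]⟩

theorem coe_unitVec (x : E3) (hx : x ≠ 0) : (unitVec x hx : E3) = ‖x‖⁻¹ • x := rfl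

theorem norm_coe (a : S2) : ‖(a : E3)‖ = 1 := by simp

theorem inner_coe_self (a : S2) : ⟪(a : E3), a⟫_ℝ = 1 := by
  rw [real_inner_self_eq_norm_sq, norm_coe]; norm_num

theorem coe_ne_zero (a : S2) : (a : E3) ≠ 0 := by
  intro h; have := norm_coe a; simp [h] at this

theorem inner_unitVec (x : E3) (hx : x ≠ 0) (y : E3) :
    ⟪(unitVec x hx : E3), y⟫_ℝ = ‖x‖⁻¹ * ⟪x, y⟫_ℝ := by
  rw [coe_unitVec, real_inner_smul_left]

theorem inner_unitVec_right (x : E3) (hx : x ≠ 0) (y : E3) :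
    ⟪y, (unitVec x hx : E3)⟫_ℝ = ‖x‖⁻¹ * ⟪y, x⟫_ℝ := by
  rw [coe_unitVec, real_inner_smul_right]

theorem inner_coe_le_one (a b : S2) : ⟪(a : E3), b⟫_ℝ ≤ 1 := by
  simpa [norm_coe] using real_inner_le_norm (a : E3) b

theorem neg_one_le_inner_coe (a b : S2) : -1 ≤ ⟪(a : E3), b⟫_ℝ := by
  have := neg_le_of_abs_le (abs_real_inner_le_norm (a : E3) b)
  simpa [norm_coe] using this

theorem inner_coe_eq_one {a b : S2} : ⟪(a : E3), b⟫_ℝ = 1 ↔ a = b := by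
  rw [inner_eq_one_iff_of_norm_eq_one (norm_coe a) (norm_coe b), Subtype.ext_iff]

theorem inner_coe_eq_neg_one {a b : S2} : ⟪(a : E3), b⟫_ℝ = -1 ↔ a = -b := by
  rw [inner_eq_neg_one_iff_of_norm_eq_one (norm_coe a) (norm_coe b), Subtype.ext_iff]
  rfl

theorem inner_coe_lt_one {a b : S2} (h : a ≠ b) : ⟪(a : E3), b⟫_ℝ < 1 :=
  lt_of_le_of_ne (inner_coe_le_one a b) (fun e => h (inner_coe_eq_one.1 e))

theorem neg_one_lt_inner_coe {a b : S2} (h : a ≠ -b) : -1 < ⟪(a : E3), b⟫_ℝ :=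
  lt_of_le_of_ne (neg_one_le_inner_coe a b) (fun e => h (inner_coe_eq_neg_one.1 e.symm))

theorem sdist_eq_arccos (a b : S2) : sdist a b = arccos ⟪(a : E3), b⟫_ℝ := by
  simp [sdist, InnerProductGeometry.angle]

theorem cos_sdist (a b : S2) : cos (sdist a b) = ⟪(a : E3), b⟫_ℝ := by
  rw [sdist_eq_arccos, cos_arccos (neg_one_le_inner_coe a b) (inner_coe_le_one a b)]

theorem continuous_inner_coe (x : E3) : Continuous fun p : S2 => ⟪x, (p : E3)⟫_ℝ := by fun_prop

theorem exists_ne_ne_neg (k : S2) : ∃ m : S2, m ≠ k ∧ m ≠ -k := by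
  by_contra! h
  let a : S2 := ⟨EuclideanSpace.single 0 1, by simp⟩
  let b : S2 := ⟨EuclideanSpace.single 1 1, by simp⟩
  have hab : ⟪(a : E3), b⟫_ℝ = 0 := by simp [a, b, EuclideanSpace.inner_single_left]
  have ha : a = k ∨ a = -k := or_iff_not_imp_left.2 (h a)
  have hb : b = k ∨ b = -k := or_iff_not_imp_left.2 (h b)
  rcases ha with ha | ha <;> rcases hb with hb | hb <;> rw [ha, hb] at hab <;>
    simp at hab

/-- The component of a unit vector orthogonal to another one. -/
theorem norm_sub_inner_smul_sq (g h : S2) :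
    ‖(h : E3) - ⟪(g : E3), h⟫_ℝ • (g : E3)‖ ^ 2 = 1 - ⟪(g : E3), h⟫_ℝ ^ 2 := by
  rw [← real_inner_self_eq_norm_sq]
  simp only [inner_sub_left, inner_sub_right, real_inner_smul_left, real_inner_smul_right,
    inner_coe_self, real_inner_comm (g : E3) (h : E3)]
  ring

/-- With w = ⟨g, h⟩, the unnormalized semicircle centers both have squared norm 1 - w² and their
inner product is -w(1 - w²). -/
theorem luneThickness_eq (g h : S2) (h₁ : h ≠ g) (h₂ : h ≠ -g) :
    luneThickness g h = arccos (-⟪(g : E3), h⟫_ℝ) := by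
  set w := ⟪(g : E3), h⟫_ℝ with hw
  have hw1 : w < 1 := inner_coe_lt_one (Ne.symm h₁)
  have hw2 : -1 < w := by
    rw [hw, real_inner_comm]; exact neg_one_lt_inner_coe h₂
  have hs : 0 < 1 - w ^ 2 := by nlinarith
  have n1 := norm_sub_inner_smul_sq g h
  have n2 := norm_sub_inner_smul_sq h g
  rw [real_inner_comm (g : E3) (h : E3)] at n2
  rw [← hw] at n1 n2
  have p1 : 0 < ‖(h : E3) - w • (g : E3)‖ := by
    by_contra hh
    have := norm_nonneg ((h : E3) - w • (g : E3))
    nlinarith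
  have heq : ‖(g : E3) - w • (h : E3)‖ = ‖(h : E3) - w • (g : E3)‖ := by
    rw [← sq_eq_sq₀ (norm_nonneg _) (norm_nonneg _), n1, n2]
  rw [luneThickness, semicircleCenter, semicircleCenter, real_inner_comm (g : E3) (h : E3), ← hw,
    heq, InnerProductGeometry.angle_smul_left_of_pos _ _ (inv_pos.2 p1),
    InnerProductGeometry.angle_smul_right_of_pos _ _ (inv_pos.2 p1), InnerProductGeometry.angle,
    heq, ← sq, n1]
  congr 1
  rw [div_eq_iff hs.ne']
  simp only [inner_sub_left, inner_sub_right, real_inner_smul_left, real_inner_smul_right,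
    inner_coe_self, real_inner_comm (g : E3) (h : E3), ← hw]
  ring

/-! ### The polar of a set -/

/-- The centers of the hemispheres that contain `C`. -/
def polar (C : Set S2) : Set S2 := {m | ∀ p ∈ C, 0 ≤ ⟪(m : E3), p⟫_ℝ}

theorem unitVec_mem_polar {C : Set S2} {x : E3} (hx : x ≠ 0) (h : ∀ p ∈ C, 0 ≤ ⟪x, (p : E3)⟫_ℝ) :
    unitVec x hx ∈ polar C := fun p hp => by
  rw [inner_unitVec]; exact mul_nonneg (by positivity) (h p hp)

theorem isClosed_polar (C : Set S2) : IsClosed (polar C) := by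
  have : polar C = ⋂ p ∈ C, {m : S2 | 0 ≤ ⟪(m : E3), p⟫_ℝ} := by ext; simp [polar]
  rw [this]
  exact isClosed_biInter fun p _ => isClosed_le continuous_const (by fun_prop)

theorem isCompact_polar (C : Set S2) : IsCompact (polar C) := (isClosed_polar C).isCompact

/-- Moving a point of an open subset of the sphere slightly in a given direction. -/
theorem exists_mem_open_add_smul {U : Set S2} (hU : IsOpen U) {p : S2} (hp : p ∈ U) (y : E3) :
    ∃ t : ℝ, 0 < t ∧ t < 1 ∧ ∃ hne : (p : E3) + t • y ≠ 0, unitVec ((p : E3) + t • y) hne ∈ U := by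
  have hc : Continuous fun t : ℝ => (p : E3) + t • y := by fun_prop
  have h0 : ∀ᶠ t in nhds (0 : ℝ), (p : E3) + t • y ≠ 0 := by
    refine hc.continuousAt.eventually_ne ?_
    simpa using coe_ne_zero p
  obtain ⟨V, hV, rfl⟩ := isOpen_induced_iff.1 hU
  have h1 : ∀ᶠ t in nhds (0 : ℝ), ‖(p : E3) + t • y‖⁻¹ • ((p : E3) + t • y) ∈ V := by
    have hc2 : ContinuousAt (fun t : ℝ => ‖(p : E3) + t • y‖⁻¹ • ((p : E3) + t • y)) 0 := by
      refine ContinuousAt.smul (ContinuousAt.inv₀ hc.norm.continuousAt ?_) hc.continuousAt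
      simp
    refine hc2.eventually_mem (hV.mem_nhds ?_)
    simpa using hp
  obtain ⟨ε, hε, hh⟩ := Metric.eventually_nhds_iff.1 (h0.and h1)
  have hm : 0 < min (ε / 2) (1 / 2) := by positivity
  have := hh (y := min (ε / 2) (1 / 2)) (by
    rw [dist_zero_right, norm_of_nonneg hm.le]
    linarith [min_le_left (ε / 2) (1 / 2)])
  exact ⟨min (ε / 2) (1 / 2), hm, by linarith [min_le_right (ε / 2) (1 / 2)], this.1, this.2⟩

theorem exists_mem_open_inner_ne_zero {U : Set S2} (hU : IsOpen U) (hne : U.Nonempty) {y : E3}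
    (hy : y ≠ 0) : ∃ p ∈ U, ⟪y, (p : E3)⟫_ℝ ≠ 0 := by
  obtain ⟨p, hp⟩ := hne
  by_cases h : ⟪y, (p : E3)⟫_ℝ = 0
  · obtain ⟨t, ht, -, hne, hmem⟩ := exists_mem_open_add_smul hU hp y
    refine ⟨_, hmem, ?_⟩
    rw [inner_unitVec_right, inner_add_right, h, real_inner_smul_right, real_inner_self_eq_norm_sq]
    have := norm_pos_iff.2 hne
    have := norm_pos_iff.2 hy
    positivity
  · exact ⟨p, hp, h⟩

/-- Two opposite hemispheres meet only in a great circle, which has no interior. -/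
theorem IsConvexBody.neg_notMem_polar {C : Set S2} (hC : IsConvexBody C) {k : S2}
    (hk : k ∈ polar C) : -k ∉ polar C := by
  intro h
  obtain ⟨p, hp, hne⟩ := exists_mem_open_inner_ne_zero isOpen_interior hC.2.2 (coe_ne_zero k)
  have h1 := hk p (interior_subset hp)
  have h2 := h p (interior_subset hp)
  have h3 : ⟪((-k : S2) : E3), (p : E3)⟫_ℝ = -⟪(k : E3), p⟫_ℝ := by
    rw [show ((-k : S2) : E3) = -(k : E3) from rfl, inner_neg_left]
  exact hne (by linarith)

theorem notMem_interior_of_inner_eq_zero {C : Set S2} {m p : S2} (hm : m ∈ polar C)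
    (h0 : ⟪(m : E3), p⟫_ℝ = 0) : p ∉ interior C := by
  intro hp
  obtain ⟨t, ht, -, hne, hmem⟩ := exists_mem_open_add_smul isOpen_interior hp (-(m : E3))
  have := hm _ (interior_subset hmem)
  rw [inner_unitVec_right, inner_add_right, h0, real_inner_smul_right, inner_neg_right,
    inner_coe_self] at this
  have := norm_pos_iff.2 hne
  have : 0 < ‖(p : E3) + t • -(m : E3)‖⁻¹ * t := by positivity
  linarith

/-- Replaces the condition on frontiers by an equation: a point of the bounding great circle is
interior neither to C nor to the hemisphere, since a small step towards -m leaves both. -/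
theorem supports_iff {C : Set S2} (hC : IsClosed C) (m : S2) :
    Supports m C ↔ m ∈ polar C ∧ ∃ p ∈ C, ⟪(m : E3), p⟫_ℝ = 0 := by
  have hsub : C ⊆ hemisphere m ↔ m ∈ polar C :=
    ⟨fun h p hp => (mem_hemisphere m p).1 (h hp), fun h p hp => (mem_hemisphere m p).2 (h p hp)⟩
  rw [Supports, hsub]
  refine and_congr_right fun hm => ⟨?_, ?_⟩
  · rintro ⟨p, hp, hp'⟩
    have hpC := hC.frontier_subset hp
    refine ⟨p, hpC, le_antisymm ?_ (hm p hpC)⟩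
    by_contra! hpos
    refine hp'.2 (mem_interior.2 ⟨{q : S2 | 0 < ⟪(m : E3), q⟫_ℝ}, ?_, ?_, hpos⟩)
    · exact fun q hq => (mem_hemisphere m q).2 (le_of_lt hq)
    · exact isOpen_lt continuous_const (continuous_inner_coe _)
  · rintro ⟨p, hp, h0⟩
    refine ⟨p, ⟨subset_closure hp, notMem_interior_of_inner_eq_zero hm h0⟩, subset_closure
      ((mem_hemisphere m p).2 h0.ge), notMem_interior_of_inner_eq_zero (C := hemisphere m) ?_ h0⟩
    exact fun q hq => (mem_hemisphere m q).1 hq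

/-! ### Separation -/

/-- The open cone over a set without its apex. -/
def openCone (C : Set S2) : Set E3 := {x | ∃ t : ℝ, 0 < t ∧ ∃ r ∈ C, x = t • (r : E3)}

theorem openCone_add_mem {C : Set S2} (hC : IsConvex C) {x y : E3} (hx : x ∈ openCone C)
    (hy : y ∈ openCone C) : x + y ∈ openCone C := by
  obtain ⟨t, ht, r, hr, rfl⟩ := hx
  obtain ⟨s, hs, q, hq, rfl⟩ := hy
  have hne : t • (r : E3) + s • (q : E3) ≠ 0 := by
    intro h
    have h1 : t • (r : E3) = -(s • (q : E3)) := eq_neg_of_add_eq_zero_left h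
    have h2 : t = s := by
      have := congrArg norm h1
      simpa [norm_smul, norm_neg, norm_coe, abs_of_pos ht, abs_of_pos hs] using this
    subst h2
    have h3 : (r : E3) = -(q : E3) := by
      rw [← smul_neg] at h1
      exact smul_right_injective _ ht.ne' h1
    have h4 : r = -q := Subtype.ext h3
    exact hC.1 q hq (h4 ▸ hr)
  refine ⟨‖t • (r : E3) + s • (q : E3)‖, norm_pos_iff.2 hne, unitVec _ hne, ?_, ?_⟩
  · refine hC.2 r hr q hq ⟨‖t • (r : E3) + s • (q : E3)‖⁻¹ * t,
      ‖t • (r : E3) + s • (q : E3)‖⁻¹ * s, by positivity, by positivity, ?_⟩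
    rw [coe_unitVec, smul_add, smul_smul, smul_smul]
  · rw [coe_unitVec, smul_smul, mul_inv_cancel₀ (norm_ne_zero_iff.2 hne), one_smul]

theorem convex_openCone {C : Set S2} (hC : IsConvex C) : Convex ℝ (openCone C) := by
  have hsm : ∀ x ∈ openCone C, ∀ a : ℝ, 0 < a → a • x ∈ openCone C := by
    rintro x ⟨t, ht, r, hr, rfl⟩ a ha
    exact ⟨a * t, by positivity, r, hr, by rw [smul_smul]⟩
  rw [convex_iff_forall_pos]
  intro x hx y hy a b ha hb _
  exact openCone_add_mem hC (hsm x hx a ha) (hsm y hy b hb)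

/-- Passes from spherical to Euclidean convexity: the hull avoids the origin and meets the ray
through a point of the sphere only if that point is in C. -/
theorem convexHull_subset_openCone {C : Set S2} (hC : IsConvex C) :
    convexHull ℝ ((fun p : S2 => (p : E3)) '' C) ⊆ openCone C := by
  refine convexHull_min ?_ (convex_openCone hC)
  rintro _ ⟨p, hp, rfl⟩
  exact ⟨1, one_pos, p, hp, by simp⟩

theorem zero_notMem_openCone (C : Set S2) : (0 : E3) ∉ openCone C := by
  rintro ⟨t, ht, r, -, h⟩
  rcases smul_eq_zero.1 h.symm with h | h
  · exact ht.ne' h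
  · exact coe_ne_zero r h

theorem mem_of_smul_mem_openCone {C : Set S2} {p : S2} {t : ℝ} (ht : 0 ≤ t)
    (h : t • (p : E3) ∈ openCone C) : p ∈ C := by
  obtain ⟨s, hs, r, hr, he⟩ := h
  have h2 : t = s := by
    have := congrArg norm he
    simpa [norm_smul, norm_coe, abs_of_nonneg ht, abs_of_pos hs] using this
  subst h2
  have : p = r := Subtype.ext (smul_right_injective _ hs.ne' he)
  exact this ▸ hr

theorem exists_pos_le_inner {C : Set S2} (hC : IsClosed C) {x : E3}
    (h : ∀ p ∈ C, 0 < ⟪x, (p : E3)⟫_ℝ) : ∃ ε : ℝ, 0 < ε ∧ ∀ p ∈ C, ε ≤ ⟪x, (p : E3)⟫_ℝ := by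
  rcases C.eq_empty_or_nonempty with rfl | hne
  · exact ⟨1, one_pos, by simp⟩
  · obtain ⟨p, hp, hmin⟩ := hC.isCompact.exists_isMinOn hne (continuous_inner_coe x).continuousOn
    exact ⟨_, h p hp, fun q hq => hmin hq⟩

/-- A convex combination of at most `n` points can be written with exactly `n` points. -/
theorem exists_fin_convex_combination {E ι : Type*} [AddCommGroup E] [Module ℝ E] [Fintype ι]
    [Nonempty ι] {n : ℕ} (hn : Fintype.card ι ≤ n) {s : Set E} {z : ι → E} {w : ι → ℝ}
    (hz : ∀ i, z i ∈ s) (hw : ∀ i, 0 ≤ w i) :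
    ∃ (z' : Fin n → E) (w' : Fin n → ℝ), (∀ i, z' i ∈ s) ∧ (∀ i, 0 ≤ w' i) ∧
      ∑ i, w' i = ∑ i, w i ∧ ∑ i, w' i • z' i = ∑ i, w i • z i := by
  obtain ⟨f⟩ := Function.Embedding.nonempty_of_card_le (by simpa using hn : Fintype.card ι ≤
    Fintype.card (Fin n))
  let i₀ : ι := Classical.arbitrary ι
  have hout : ∀ j ∉ Set.range f, Function.extend f w 0 j = 0 := fun j hj => by
    rw [Function.extend_apply' _ _ _ (fun h => hj h)]; rfl
  refine ⟨Function.extend f z fun _ => z i₀, Function.extend f w 0, fun j => ?_, fun j => ?_, ?_, ?_⟩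
  · by_cases hj : ∃ i, f i = j
    · obtain ⟨i, rfl⟩ := hj
      rw [f.injective.extend_apply]; exact hz i
    · rw [Function.extend_apply' _ _ _ hj]; exact hz i₀
  · by_cases hj : ∃ i, f i = j
    · obtain ⟨i, rfl⟩ := hj
      rw [f.injective.extend_apply]; exact hw i
    · rw [hout j hj]
  · exact (Fintype.sum_of_injective f f.injective _ _ hout
      fun i => by rw [f.injective.extend_apply]).symm
  · exact (Fintype.sum_of_injective f f.injective _ _ (fun j hj => by rw [hout j hj, zero_smul])
      fun i => by rw [f.injective.extend_apply, f.injective.extend_apply]).symm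

/-- Carathéodory: `finrank + 1` points suffice, so the hull is a continuous image of a simplex times
a power of s. -/
theorem isCompact_convexHull_of_finiteDimensional {E : Type*} [NormedAddCommGroup E]
    [NormedSpace ℝ E] [FiniteDimensional ℝ E] {s : Set E} (hs : IsCompact s) :
    IsCompact (convexHull ℝ s) := by
  let n := Module.finrank ℝ E + 1
  have heq : convexHull ℝ s = (fun q : (Fin n → ℝ) × (Fin n → E) => ∑ i, q.1 i • q.2 i) ''
      (stdSimplex ℝ (Fin n) ×ˢ Set.univ.pi fun _ => s) := by
    refine Subset.antisymm (fun x hx => ?_) ?_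
    · obtain ⟨ι, _, z, w, hz, hind, hw, hsum, rfl⟩ := eq_pos_convex_span_of_mem_convexHull hx
      have hne : Nonempty ι := by
        by_contra h
        rw [not_nonempty_iff] at h
        simp at hsum
      obtain ⟨z', w', h1, h2, h3, h4⟩ := exists_fin_convex_combination (n := n)
        (hind.card_le_finrank_succ.trans (Nat.succ_le_succ (Submodule.finrank_le _)))
        (fun i => hz ⟨i, rfl⟩) (fun i => (hw i).le)
      exact ⟨(w', z'), ⟨⟨h2, h3.trans hsum⟩, fun i _ => h1 i⟩, h4⟩
    · rintro _ ⟨⟨w, z⟩, ⟨⟨hw, hsum⟩, hz⟩, rfl⟩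
      exact (convex_convexHull ℝ s).sum_mem (fun i _ => hw i) hsum
        fun i _ => subset_convexHull ℝ s (hz i trivial)
  rw [heq]
  exact ((isCompact_stdSimplex ℝ (Fin n)).prod (isCompact_univ_pi fun _ => hs)).image (by fun_prop)

theorem isCompact_convexHull_coe {C : Set S2} (hC : IsClosed C) :
    IsCompact (convexHull ℝ ((fun p : S2 => (p : E3)) '' C)) :=
  isCompact_convexHull_of_finiteDimensional (hC.isCompact.image continuous_subtype_val)

/-- A point outside a closed convex set is separated from it by a great circle. -/
theorem exists_separating {C : Set S2} (hcl : IsClosed C) (hC : IsConvex C) {p : S2} (hp : p ∉ C) :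
    ∃ y : S2, (∀ r ∈ C, 0 < ⟪(y : E3), r⟫_ℝ) ∧ ⟪(y : E3), p⟫_ℝ < 0 := by
  -- Separating from the whole ray, not only from p, makes the functional nonnegative at p.
  let ray : Set E3 := (fun t : ℝ => t • (p : E3)) '' Ici 0
  have hrayc : Convex ℝ ray :=
    (convex_Ici (0 : ℝ)).linear_image (LinearMap.toSpanSingleton ℝ E3 (p : E3))
  have hraycl : IsClosed ray :=
    (isClosedEmbedding_smul_left (coe_ne_zero p)).isClosedMap _ isClosed_Ici
  have hdisj : Disjoint (convexHull ℝ ((fun p : S2 => (p : E3)) '' C)) ray := by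
    rw [Set.disjoint_left]
    rintro _ hx ⟨t, ht, rfl⟩
    exact hp (mem_of_smul_mem_openCone ht (convexHull_subset_openCone hC hx))
  obtain ⟨f, u, v, h1, h2, h3⟩ := geometric_hahn_banach_compact_closed (convex_convexHull ℝ _)
    (isCompact_convexHull_coe hcl) hrayc hraycl hdisj
  set y := (InnerProductSpace.toDual ℝ E3).symm f with hy
  have hfy : ∀ x, f x = ⟪y, x⟫_ℝ := fun x => by rw [hy, InnerProductSpace.toDual_symm_apply]
  have hv : v < 0 := by simpa using h3 _ ⟨0, by simp, rfl⟩
  have hfp : 0 ≤ ⟪y, (p : E3)⟫_ℝ := by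
    by_contra! hneg
    have := h3 _ ⟨v / ⟪y, (p : E3)⟫_ℝ, div_nonneg_of_nonpos hv.le hneg.le, rfl⟩
    simp only [hfy, real_inner_smul_right] at this
    rw [div_mul_cancel₀ _ hneg.ne] at this
    exact lt_irrefl _ this
  have hC1 : ∀ r ∈ C, ⟪y, (r : E3)⟫_ℝ < u := fun r hr => by
    rw [← hfy]; exact h1 _ (subset_convexHull ℝ _ ⟨r, hr, rfl⟩)
  have hpos : 0 < -u := by linarith
  -- The functional may vanish at p. Tilting by half of the gap -u makes the value at p negative and
  -- keeps the values on C positive.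
  set x : E3 := -y - (-u / 2) • (p : E3) with hx
  have hxr : ∀ r ∈ C, 0 < ⟪x, (r : E3)⟫_ℝ := fun r hr => by
    rw [hx, inner_sub_left, inner_neg_left, real_inner_smul_left]
    have := hC1 r hr
    have := inner_coe_le_one p r
    nlinarith
  have hxp : ⟪x, (p : E3)⟫_ℝ < 0 := by
    rw [hx, inner_sub_left, inner_neg_left, real_inner_smul_left, inner_coe_self]
    linarith
  have hx0 : x ≠ 0 := by rintro h; simp [h] at hxp
  have hn := inv_pos.2 (norm_pos_iff.2 hx0)
  refine ⟨unitVec x hx0, fun r hr => ?_, ?_⟩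
  · rw [inner_unitVec]; exact mul_pos hn (hxr r hr)
  · rw [inner_unitVec]; exact mul_neg_of_pos_of_neg hn hxp

/-- The bipolar theorem; it is how points are shown to belong to a body. -/
theorem mem_of_forall_polar {C : Set S2} (hC : IsConvexBody C) {p : S2}
    (h : ∀ y ∈ polar C, 0 ≤ ⟪(y : E3), p⟫_ℝ) : p ∈ C := by
  by_contra hp
  obtain ⟨y, hy, hyp⟩ := exists_separating hC.1 hC.2.1 hp
  exact absurd (h y fun r hr => (hy r hr).le) (not_le.2 hyp)

/-! ### Thickness as the complement of the diameter of the polar -/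

/-- The center of a hemisphere containing `C` in its interior can be moved away from any point. -/
theorem exists_mem_polar_inner_lt {C : Set S2} (hC : IsClosed C) {k m : S2}
    (hk : ∀ p ∈ C, 0 < ⟪(k : E3), p⟫_ℝ) (h₁ : m ≠ k) (h₂ : m ≠ -k) :
    ∃ k' ∈ polar C, ⟪(k' : E3), m⟫_ℝ < ⟪(k : E3), m⟫_ℝ := by
  obtain ⟨ε, hε, hle⟩ := exists_pos_le_inner hC hk
  set w := ⟪(k : E3), m⟫_ℝ with hw
  have hw1 : w < 1 := inner_coe_lt_one (Ne.symm h₁)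
  have hw2 : -1 < w := by
    rw [hw, real_inner_comm]; exact neg_one_lt_inner_coe h₂
  have hs : 0 < 1 - w ^ 2 := by nlinarith
  set a : E3 := (m : E3) - w • (k : E3) with ha
  have hka : ⟪(k : E3), a⟫_ℝ = 0 := by
    rw [ha, inner_sub_right, real_inner_smul_right, inner_coe_self, ← hw]; ring
  have ham : ⟪a, (m : E3)⟫_ℝ = 1 - w ^ 2 := by
    rw [ha, inner_sub_left, real_inner_smul_left, inner_coe_self, ← hw]; ring
  have hna : ‖a‖ ^ 2 = 1 - w ^ 2 := norm_sub_inner_smul_sq k m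
  have hna1 : ‖a‖ ≤ 1 := by nlinarith [norm_nonneg a, sq_nonneg w]
  -- t ≤ ε keeps the moved center in the polar because ‖a‖ ≤ 1; t ≤ 1 makes the second-order effect
  -- of normalizing smaller than the first-order gain when w < 0.
  set t := min ε 1 with ht
  have ht0 : 0 < t := lt_min hε one_pos
  set x : E3 := (k : E3) - t • a with hx
  have hnx : ‖x‖ ^ 2 = 1 + t ^ 2 * (1 - w ^ 2) := by
    rw [hx, norm_sub_sq_real, real_inner_smul_right, hka, norm_smul, mul_pow, hna, norm_coe,
      norm_of_nonneg ht0.le]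
    ring
  have hnx1 : 1 ≤ ‖x‖ := by nlinarith [norm_nonneg x, mul_pos (pow_pos ht0 2) hs]
  have hnx2 : ‖x‖ ≤ 1 + t ^ 2 * (1 - w ^ 2) / 2 := by
    nlinarith [norm_nonneg x, mul_pos (pow_pos ht0 2) hs]
  have hx0 : x ≠ 0 := by rintro h; rw [h, norm_zero] at hnx1; linarith
  refine ⟨unitVec x hx0, unitVec_mem_polar hx0 fun p hp => ?_, ?_⟩
  · have h3 : ⟪a, (p : E3)⟫_ℝ ≤ 1 := by
      have := real_inner_le_norm a (p : E3)
      rw [norm_coe] at this; linarith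
    rw [hx, inner_sub_left, real_inner_smul_left]
    have := hle p hp
    have : t ≤ ε := min_le_left _ _
    nlinarith
  · rw [inner_unitVec, inv_mul_lt_iff₀ (by linarith), hx, inner_sub_left, real_inner_smul_left, ham,
      ← hw]
    have ht1 : t ≤ 1 := min_le_right _ _
    have h5 : 0 < t * (1 - w ^ 2) := by positivity
    rcases le_or_gt 0 w with h | h
    · nlinarith
    · nlinarith [mul_pos ht0 h5]

/-- A convex body is contained in the interior of some hemisphere. -/
theorem IsConvexBody.exists_polar_pos {C : Set S2} (hC : IsConvexBody C) :
    ∃ y : S2, ∀ r ∈ C, 0 < ⟪(y : E3), r⟫_ℝ := by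
  obtain ⟨p, hp⟩ := hC.2.2
  obtain ⟨y, hy, -⟩ := exists_separating hC.1 hC.2.1 (hC.2.1.1 p (interior_subset hp))
  exact ⟨y, hy⟩

/-- A pair of points of the polar at the largest possible distance realizes the thickness. -/
theorem IsConvexBody.exists_diametral {C : Set S2} (hC : IsConvexBody C) :
    0 < thickness C ∧ thickness C < π ∧
    (∃ k ∈ polar C, ∃ m ∈ polar C, ⟪(k : E3), m⟫_ℝ = -cos (thickness C)) ∧
    ∀ k ∈ polar C, ∀ m ∈ polar C, -cos (thickness C) ≤ ⟪(k : E3), m⟫_ℝ := by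
  obtain ⟨y, hy⟩ := hC.exists_polar_pos
  have hyp : y ∈ polar C := fun p hp => (hy p hp).le
  obtain ⟨⟨k, m⟩, ⟨hk, hm⟩, hmin⟩ := ((isCompact_polar C).prod (isCompact_polar C)).exists_isMinOn
    ⟨(y, y), hyp, hyp⟩ (f := fun q : S2 × S2 => ⟪(q.1 : E3), (q.2 : E3)⟫_ℝ) (by fun_prop)
  have hmin' : ∀ k' ∈ polar C, ∀ m' ∈ polar C, ⟪(k : E3), m⟫_ℝ ≤ ⟪(k' : E3), m'⟫_ℝ :=
    fun k' hk' m' hm' => hmin (show (k', m') ∈ polar C ×ˢ polar C from ⟨hk', hm'⟩)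
  simp only at hk hm
  -- The polar has more than one point, because a hemisphere with C in its interior can be moved.
  have hkm : m ≠ k := by
    rintro rfl
    obtain ⟨z, hz1, hz2⟩ := exists_ne_ne_neg y
    obtain ⟨k', hk', hlt⟩ := exists_mem_polar_inner_lt hC.1 hy hz1 hz2
    have h1 := hmin' y hyp k' hk'
    rw [inner_coe_self] at h1
    have : y = k' := inner_coe_eq_one.1 (le_antisymm (inner_coe_le_one _ _) h1)
    rw [this] at hlt
    exact lt_irrefl _ hlt
  have hneg : ∀ a ∈ polar C, ∀ b ∈ polar C, a ≠ -b := fun a ha b hb h =>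
    hC.neg_notMem_polar hb (h ▸ ha)
  -- Otherwise a could be moved farther from b inside the polar. So both hemispheres of an extremal
  -- pair support C.
  have hzero : ∀ a ∈ polar C, ∀ b ∈ polar C, b ≠ a → ⟪(a : E3), b⟫_ℝ = ⟪(k : E3), m⟫_ℝ →
      ∃ p ∈ C, ⟪(a : E3), p⟫_ℝ = 0 := by
    intro a ha b hb hne he
    by_contra! h
    obtain ⟨k', hk', hlt⟩ := exists_mem_polar_inner_lt hC.1
      (fun p hp => lt_of_le_of_ne (ha p hp) (h p hp).symm) hne (hneg b hb a ha)
    exact absurd (hmin' k' hk' b hb) (not_le.2 (he ▸ hlt))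
  have hsk : Supports k C := (supports_iff hC.1 k).2 ⟨hk, hzero k hk m hm hkm rfl⟩
  have hsm : Supports m C :=
    (supports_iff hC.1 m).2 ⟨hm, hzero m hm k hk (Ne.symm hkm) (real_inner_comm _ _)⟩
  have hlow : ∀ a, Supports a C → arccos (-⟪(k : E3), m⟫_ℝ) ≤ width a C := by
    intro a ha
    have hap := ((supports_iff hC.1 a).1 ha).1
    refine le_csInf ?_ ?_
    · by_cases h : m = a
      · exact ⟨_, k, hsk, fun h' => hkm (h.trans h'.symm), hneg k hk a hap, rfl⟩
      · exact ⟨_, m, hsm, h, hneg m hm a hap, rfl⟩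
    · rintro w ⟨b, hb, h1, h2, rfl⟩
      rw [luneThickness_eq a b h1 h2]
      exact arccos_le_arccos (neg_le_neg (hmin' a hap b ((supports_iff hC.1 b).1 hb).1))
  have hth : thickness C = arccos (-⟪(k : E3), m⟫_ℝ) := by
    refine le_antisymm ?_ (le_csInf ⟨_, k, hsk, rfl⟩ ?_)
    · have hle : thickness C ≤ width k C :=
        csInf_le ⟨arccos (-⟪(k : E3), m⟫_ℝ), by rintro w ⟨a, ha, rfl⟩; exact hlow a ha⟩
          ⟨k, hsk, rfl⟩
      refine hle.trans (csInf_le ⟨0, ?_⟩ ?_)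
      · rintro w ⟨b, -, -, -, rfl⟩; exact InnerProductGeometry.angle_nonneg _ _
      · exact ⟨m, hsm, hkm, hneg m hm k hk, (luneThickness_eq k m hkm (hneg m hm k hk)).symm⟩
    · rintro w ⟨a, ha, rfl⟩; exact hlow a ha
  have hlt1 : ⟪(k : E3), m⟫_ℝ < 1 := inner_coe_lt_one (Ne.symm hkm)
  have hgt : -1 < ⟪(k : E3), m⟫_ℝ := neg_one_lt_inner_coe (hneg k hk m hm)
  have hcos : -cos (thickness C) = ⟪(k : E3), m⟫_ℝ := by
    rw [hth, cos_arccos (by linarith) (by linarith), neg_neg]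
  refine ⟨?_, ?_, ⟨k, hk, m, hm, hcos.symm⟩, fun k' hk' m' hm' => hcos ▸ hmin' k' hk' m' hm'⟩
  · rw [hth, arccos_pos]; linarith
  · rw [hth]
    refine lt_of_le_of_ne (arccos_le_pi _) fun h => ?_
    rw [arccos_eq_pi] at h
    linarith

theorem IsConvexBody.thickness_eq {C : Set S2} (hC : IsConvexBody C) {δ : ℝ} (h0 : 0 ≤ δ)
    (hπ : δ ≤ π) {k m : S2} (hk : k ∈ polar C) (hm : m ∈ polar C) (he : ⟪(k : E3), m⟫_ℝ = -cos δ)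
    (hmin : ∀ k ∈ polar C, ∀ m ∈ polar C, -cos δ ≤ ⟪(k : E3), m⟫_ℝ) : thickness C = δ := by
  obtain ⟨h1, h2, ⟨a, ha, b, hb, hab⟩, h3⟩ := hC.exists_diametral
  have h4 := hmin a ha b hb
  have h5 := h3 k hk m hm
  exact injOn_cos ⟨h1.le, h2.le⟩ ⟨h0, hπ⟩ (by linarith)

/-- A hemisphere that contains `C` in its interior takes no part in a lune of least thickness. -/
theorem IsConvexBody.neg_cos_thickness_lt {C : Set S2} (hC : IsConvexBody C) {k m : S2}
    (hk : ∀ p ∈ C, 0 < ⟪(k : E3), p⟫_ℝ) (hm : m ∈ polar C) :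
    -cos (thickness C) < ⟪(k : E3), m⟫_ℝ := by
  obtain ⟨h1, h2, -, h3⟩ := hC.exists_diametral
  have hkp : k ∈ polar C := fun p hp => (hk p hp).le
  by_cases h : m = k
  · rw [h, inner_coe_self]
    have : cos π < cos (thickness C) := cos_lt_cos_of_nonneg_of_le_pi h1.le le_rfl h2
    rw [cos_pi] at this; linarith
  · obtain ⟨k', hk', hlt⟩ := exists_mem_polar_inner_lt hC.1 hk h
      (fun h' => hC.neg_notMem_polar hkp (h' ▸ hm))
    exact (h3 k' hk' m hm).trans_lt hlt

/-! ### Lunes of least thickness -/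

/-- The centers of the semicircles bounding a lune of least thickness belong to the body. -/
theorem IsConvexBody.center_mem {C : Set S2} (hC : IsConvexBody C) (hle : thickness C ≤ π / 2)
    {k m p : S2} (hk : k ∈ polar C) (hm : m ∈ polar C) (hkm : ⟪(k : E3), m⟫_ℝ = -cos (thickness C))
    (hp : sin (thickness C) • (p : E3) = (k : E3) + cos (thickness C) • (m : E3)) : p ∈ C := by
  obtain ⟨h0, hπ, -, hmin⟩ := hC.exists_diametral
  have hS : 0 < sin (thickness C) := sin_pos_of_pos_of_lt_pi h0 hπ
  have hc : 0 ≤ cos (thickness C) := cos_nonneg_of_neg_pi_div_two_le_of_le (by linarith) hle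
  have hc1 := cos_le_one (thickness C)
  set c := cos (thickness C)
  refine mem_of_forall_polar hC fun y hy => ?_
  -- The first variation of ⟨k, m⟩ when m moves towards y within the polar; extremality makes it
  -- nonnegative. The sign of c is needed to bound c‖x‖ from above.
  have key : 0 ≤ ⟪(k : E3), y⟫_ℝ + c * ⟪(m : E3), y⟫_ℝ := by
    by_contra! hneg
    set g := ⟪(k : E3), y⟫_ℝ + c * ⟪(m : E3), y⟫_ℝ with hg
    obtain ⟨t, ht0, ht1, htg⟩ : ∃ t : ℝ, 0 < t ∧ t < 1 ∧ t < -g :=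
      ⟨min (1 / 2) (-g / 2), lt_min (by norm_num) (by linarith), by
        linarith [min_le_left (1 / 2) (-g / 2)], by linarith [min_le_right (1 / 2) (-g / 2)]⟩
    set x : E3 := (m : E3) + t • (y : E3) with hx
    have hnx : ‖x‖ ^ 2 = 1 + 2 * t * ⟪(m : E3), y⟫_ℝ + t ^ 2 := by
      rw [hx, norm_add_sq_real, real_inner_smul_right, norm_smul, norm_coe, norm_coe,
        norm_of_nonneg ht0.le]
      ring
    have hx0 : x ≠ 0 := by
      intro h
      rw [h, norm_zero] at hnx
      nlinarith [neg_one_le_inner_coe m y]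
    have hnpos := norm_pos_iff.2 hx0
    have hxp : unitVec x hx0 ∈ polar C := unitVec_mem_polar hx0 fun q hq => by
      rw [hx, inner_add_left, real_inner_smul_left]
      have := hm q hq
      have := hy q hq
      positivity
    have h1 := hmin k hk _ hxp
    rw [inner_unitVec_right, le_inv_mul_iff₀ hnpos, hx, inner_add_right, real_inner_smul_right,
      hkm, ← hx] at h1
    have h2 : ‖x‖ ≤ 1 + t * ⟪(m : E3), y⟫_ℝ + t ^ 2 / 2 := by nlinarith [sq_nonneg (‖x‖ - 1)]
    have h3 : c * ‖x‖ ≤ c * (1 + t * ⟪(m : E3), y⟫_ℝ + t ^ 2 / 2) :=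
      mul_le_mul_of_nonneg_left h2 hc
    have h4 : c * t ^ 2 ≤ t ^ 2 := by nlinarith [sq_nonneg t]
    have h5 : 0 ≤ t * (g + t / 2) := by
      rw [hg]; nlinarith
    nlinarith
  have h1 : sin (thickness C) * ⟪(y : E3), p⟫_ℝ = ⟪(k : E3), y⟫_ℝ + c * ⟪(m : E3), y⟫_ℝ := by
    rw [← real_inner_smul_right, hp, inner_add_right, real_inner_smul_right,
      real_inner_comm (k : E3), real_inner_comm (m : E3)]
  rw [← h1] at key
  exact nonneg_of_mul_nonneg_right key hS

/-- Cutting a convex body by a great circle that meets its interior. -/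
theorem IsConvexBody.inter_halfspace {R : Set S2} (hR : IsConvexBody R) {z : E3} {p : S2}
    (hp : p ∈ interior R) (hzp : 0 < ⟪z, (p : E3)⟫_ℝ) :
    IsConvexBody {r ∈ R | 0 ≤ ⟪z, (r : E3)⟫_ℝ} := by
  refine ⟨hR.1.inter (isClosed_le continuous_const (continuous_inner_coe z)), ⟨?_, ?_⟩, ?_⟩
  · exact fun a ha h => hR.2.1.1 a ha.1 h.1
  · rintro a ⟨ha, ha'⟩ b ⟨hb, hb'⟩ q hq
    refine ⟨hR.2.1.2 a ha b hb hq, ?_⟩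
    obtain ⟨s, t, hs, ht, h⟩ := hq
    rw [h, inner_add_right, real_inner_smul_right, real_inner_smul_right]
    positivity
  · refine ⟨p, mem_interior.2 ⟨interior R ∩ {q : S2 | 0 < ⟪z, (q : E3)⟫_ℝ}, ?_, ?_, hp, hzp⟩⟩
    · exact fun q hq => ⟨interior_subset hq.1, le_of_lt hq.2⟩
    · exact isOpen_interior.inter (isOpen_lt continuous_const (continuous_inner_coe z))

/-- A lune of least thickness of the cut body, with its center on the cut. -/
theorem IsReduced.exists_lune_of_cut {R : Set S2} (hR : IsReduced R) (hle : thickness R ≤ π / 2)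
    {z : E3} {e p : S2} (he : e ∈ R) (hze : ⟪z, (e : E3)⟫_ℝ < 0) (hp : p ∈ interior R)
    (hzp : 0 < ⟪z, (p : E3)⟫_ℝ) :
    ∃ k m q : S2, k ∈ polar {r ∈ R | 0 ≤ ⟪z, (r : E3)⟫_ℝ} ∧
      m ∈ polar {r ∈ R | 0 ≤ ⟪z, (r : E3)⟫_ℝ} ∧ q ∈ R ∧ ⟪z, (q : E3)⟫_ℝ = 0 ∧
      ⟪(k : E3), m⟫_ℝ ≤ -cos (thickness R) ∧ ⟪(k : E3), q⟫_ℝ = 0 ∧ 0 ≤ ⟪(m : E3), q⟫_ℝ ∧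
      √(1 - ⟪(k : E3), m⟫_ℝ ^ 2) • (q : E3) = (m : E3) - ⟪(k : E3), m⟫_ℝ • (k : E3) := by
  set Z : Set S2 := {r ∈ R | 0 ≤ ⟪z, (r : E3)⟫_ℝ} with hZ
  have hZb : IsConvexBody Z := hR.1.inter_halfspace hp hzp
  have hZR : Z ⊆ R := fun r hr => hr.1
  have hlt : thickness Z < thickness R := hR.2 Z hZb hZR fun h => by
    have : e ∈ Z := h ▸ he
    exact absurd this.2 (not_le.2 hze)
  obtain ⟨h0, hπ, ⟨k, hk, m, hm, hkm⟩, -⟩ := hZb.exists_diametral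
  obtain ⟨-, hπ', -, hminR⟩ := hR.1.exists_diametral
  have hcos : cos (thickness R) < cos (thickness Z) :=
    cos_lt_cos_of_nonneg_of_le_pi h0.le hπ'.le hlt
  have hS : 0 < sin (thickness Z) := sin_pos_of_pos_of_lt_pi h0 hπ
  -- H(k) contains Z but not R. If q were strictly inside the cut, moving it slightly towards a
  -- point r of R outside H(k) would give a point of Z outside H(k).
  have main : ∀ k ∈ polar Z, ∀ m ∈ polar Z, ⟪(k : E3), m⟫_ℝ = -cos (thickness Z) → k ∉ polar R →
      ∃ q : S2, q ∈ R ∧ ⟪z, (q : E3)⟫_ℝ = 0 ∧ ⟪(k : E3), q⟫_ℝ = 0 ∧ 0 ≤ ⟪(m : E3), q⟫_ℝ ∧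
      √(1 - ⟪(k : E3), m⟫_ℝ ^ 2) • (q : E3) = (m : E3) - ⟪(k : E3), m⟫_ℝ • (k : E3) := by
    intro k hk m hm hkm hkR
    have hsin : √(1 - ⟪(k : E3), m⟫_ℝ ^ 2) = sin (thickness Z) := by
      rw [hkm, neg_sq, ← sin_sq, sqrt_sq hS.le]
    set x : E3 := (m : E3) - ⟪(k : E3), m⟫_ℝ • (k : E3) with hx
    have hnx : ‖x‖ = sin (thickness Z) := by
      rw [← sq_eq_sq₀ (norm_nonneg _) hS.le, norm_sub_inner_smul_sq, hkm, neg_sq, ← sin_sq]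
    have hx0 : x ≠ 0 := by
      rw [← norm_pos_iff, hnx]; exact hS
    set q := unitVec x hx0 with hq
    have hSq : sin (thickness Z) • (q : E3) = x := by
      rw [hq, coe_unitVec, hnx, smul_smul, mul_inv_cancel₀ hS.ne', one_smul]
    have hqZ : q ∈ Z := by
      refine hZb.center_mem (hlt.le.trans hle) hm hk ?_ (hSq.trans ?_)
      · rw [real_inner_comm, hkm]
      · rw [hx, hkm, neg_smul, sub_neg_eq_add]
    have hkq : ⟪(k : E3), q⟫_ℝ = 0 := by
      rw [hq, inner_unitVec_right, hx, inner_sub_right, real_inner_smul_right, inner_coe_self]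
      ring
    refine ⟨q, hqZ.1, ?_, hkq, hm q hqZ, by rw [hsin, hSq]⟩
    by_contra hne
    have hpos : 0 < ⟪z, (q : E3)⟫_ℝ := lt_of_le_of_ne hqZ.2 (Ne.symm hne)
    obtain ⟨r, hr, hkr⟩ : ∃ r ∈ R, ⟪(k : E3), r⟫_ℝ < 0 := by
      by_contra! h; exact hkR h
    -- Small enough that q + t r is still on the positive side of the cut.
    set t := ⟪z, (q : E3)⟫_ℝ / (1 + |⟪z, (r : E3)⟫_ℝ|) with ht
    have ht0 : 0 < t := by positivity
    obtain ⟨s, hs, y, hy, hsy⟩ := openCone_add_mem hR.1.2.1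
      ⟨1, one_pos, q, hqZ.1, (one_smul _ _).symm⟩ ⟨t, ht0, r, hr, rfl⟩
    have hyZ : y ∈ Z := by
      refine ⟨hy, nonneg_of_mul_nonneg_right (a := s) ?_ hs⟩
      rw [← real_inner_smul_right, ← hsy, inner_add_right, real_inner_smul_right]
      have h1 : t * (1 + |⟪z, (r : E3)⟫_ℝ|) = ⟪z, (q : E3)⟫_ℝ := by
        rw [ht, div_mul_cancel₀]; positivity
      nlinarith [neg_abs_le ⟪z, (r : E3)⟫_ℝ]
    have h1 := mul_nonneg hs.le (hk y hyZ)
    rw [← real_inner_smul_right, ← hsy, inner_add_right, real_inner_smul_right, hkq] at h1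
    nlinarith
  -- A pair of polar points of R cannot be as far apart as k and m, since Z is thinner than R.
  have hor : k ∉ polar R ∨ m ∉ polar R := by
    by_contra! h
    have := hminR k h.1 m h.2
    linarith
  rcases hor with h | h
  · obtain ⟨q, h1, h2, h3, h4, h5⟩ := main k hk m hm hkm h
    exact ⟨k, m, q, hk, hm, h1, h2, by linarith, h3, h4, h5⟩
  · have hmk : ⟪(m : E3), k⟫_ℝ = -cos (thickness Z) := by rw [real_inner_comm, hkm]
    obtain ⟨q, h1, h2, h3, h4, h5⟩ := main m hm k hk hmk h
    exact ⟨m, k, q, hm, hk, h1, h2, by linarith, h3, h4, h5⟩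

/-- Every point of a reduced body exposed by a great circle is the center of one of the
semicircles bounding a lune of least thickness that contains the body. -/
theorem IsReduced.exists_lune_of_exposed {R : Set S2} (hR : IsReduced R)
    (hle : thickness R ≤ π / 2) {x : E3} {e : S2} (he : e ∈ R) (hx0 : x ≠ 0)
    (hxe : ⟪x, (e : E3)⟫_ℝ = 0) (hx : ∀ r ∈ R, r ≠ e → 0 < ⟪x, (r : E3)⟫_ℝ) :
    ∃ k : E3, ‖k‖ = 1 ∧ ⟪k, (e : E3)⟫_ℝ = 0 ∧ (∀ r ∈ R, 0 ≤ ⟪k, (r : E3)⟫_ℝ) ∧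
      (∀ r ∈ R, 0 ≤ sin (thickness R) * ⟪(e : E3), r⟫_ℝ - cos (thickness R) * ⟪k, (r : E3)⟫_ℝ) ∧
      ∃ b ∈ R, (b : E3) = cos (thickness R) • (e : E3) + sin (thickness R) • k := by
  obtain ⟨h0, hπ, -, hmin⟩ := hR.1.exists_diametral
  have hS : 0 < sin (thickness R) := sin_pos_of_pos_of_lt_pi h0 hπ
  obtain ⟨p, hp, hpne⟩ := exists_mem_open_inner_ne_zero isOpen_interior hR.1.2.2 hx0
  have hη : 0 < ⟪x, (p : E3)⟫_ℝ :=
    hx p (interior_subset hp) fun h => hpne (h ▸ hxe)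
  set η := ⟪x, (p : E3)⟫_ℝ with hηd
  -- The cuts x - ε e remove e and shrink to it; ε ≤ η/2 leaves the interior point p on the positive
  -- side.
  let ε : ℕ → ℝ := fun n => η * (1 / ((n : ℝ) + 1)) / 2
  have hε : ∀ n, 0 < ε n := fun n => by positivity
  have hε2 : ∀ n, ε n ≤ η / 2 := fun n => by
    have : 1 / ((n : ℝ) + 1) ≤ 1 := by
      rw [div_le_one (by positivity)]; linarith [n.cast_nonneg (α := ℝ)]
    simp only [ε]
    nlinarith
  have hεlim : Filter.Tendsto ε Filter.atTop (nhds 0) := by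
    have := ((tendsto_one_div_add_atTop_nhds_zero_nat (𝕜 := ℝ)).const_mul η).div_const 2
    simpa [ε] using this
  have hz : ∀ (n : ℕ) (r : S2), ⟪x - ε n • (e : E3), (r : E3)⟫_ℝ =
      ⟪x, (r : E3)⟫_ℝ - ε n * ⟪(e : E3), r⟫_ℝ := fun n r => by
    rw [inner_sub_left, real_inner_smul_left]
  have hcut : ∀ n, _ := fun n => hR.exists_lune_of_cut hle (z := x - ε n • (e : E3)) he
    (by rw [hz, hxe, inner_coe_self]; linarith [hε n]) hp
    (by rw [hz]; nlinarith [hε n, hε2 n, inner_coe_le_one e p])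
  choose k m q hk hm hqR hqz hkm hkq hmq heq using hcut
  obtain ⟨⟨k₀, m₀, q₀⟩, -, φ, hφ, hlim⟩ := isCompact_univ.tendsto_subseq
    (x := fun n => (k n, m n, q n)) (fun n => mem_univ _)
  have hk0 : Filter.Tendsto (fun n => k (φ n)) Filter.atTop (nhds k₀) :=
    (continuous_fst.tendsto _).comp hlim
  have hm0 : Filter.Tendsto (fun n => m (φ n)) Filter.atTop (nhds m₀) :=
    ((continuous_fst.comp continuous_snd).tendsto _).comp hlim
  have hq0 : Filter.Tendsto (fun n => q (φ n)) Filter.atTop (nhds q₀) :=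
    ((continuous_snd.comp continuous_snd).tendsto _).comp hlim
  have hεφ := hεlim.comp hφ.tendsto_atTop
  have hq0R : q₀ ∈ R := hR.1.1.mem_of_tendsto hq0 (Filter.Eventually.of_forall fun n => hqR _)
  have hq0x : ⟪x, (q₀ : E3)⟫_ℝ = 0 := by
    have l1 := ((continuous_inner_coe x).tendsto q₀).comp hq0
    have l2 := hεφ.mul (((continuous_inner_coe (e : E3)).tendsto q₀).comp hq0)
    rw [zero_mul] at l2
    refine tendsto_nhds_unique l1 (l2.congr fun n => ?_)
    have := hqz (φ n)
    rw [hz] at this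
    simp only [Function.comp_apply]
    linarith
  have hqe : q₀ = e := by
    by_contra h
    exact (hx q₀ hq0R h).ne' hq0x
  have hclosed : IsClosed {w : S2 × S2 × S2 | ⟪(w.1 : E3), w.2.1⟫_ℝ ≤ -cos (thickness R) ∧
      ⟪(w.1 : E3), w.2.2⟫_ℝ = 0 ∧ 0 ≤ ⟪(w.2.1 : E3), w.2.2⟫_ℝ ∧
      √(1 - ⟪(w.1 : E3), w.2.1⟫_ℝ ^ 2) • (w.2.2 : E3) =
        (w.2.1 : E3) - ⟪(w.1 : E3), w.2.1⟫_ℝ • (w.1 : E3)} := by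
    simp only [Set.ofPred_and]
    refine IsClosed.inter ?_ (IsClosed.inter ?_ (IsClosed.inter ?_ ?_))
    · exact isClosed_le (by fun_prop) (by fun_prop)
    · exact isClosed_eq (by fun_prop) (by fun_prop)
    · exact isClosed_le (by fun_prop) (by fun_prop)
    · exact isClosed_eq (by fun_prop) (by fun_prop)
  obtain ⟨c1, c2, c3, c4⟩ := hclosed.mem_of_tendsto hlim
    (Filter.Eventually.of_forall fun n => ⟨hkm (φ n), hkq (φ n), hmq (φ n), heq (φ n)⟩)
  simp only at c1 c2 c3 c4
  -- Every point of R other than e eventually survives the cut; at e = q₀ the inequality is supplied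
  -- by the last hypothesis.
  have hpol : ∀ {a : ℕ → S2} {a₀ : S2}, Filter.Tendsto (fun n => a (φ n)) Filter.atTop (nhds a₀) →
      (∀ n, a n ∈ polar {r ∈ R | 0 ≤ ⟪x - ε n • (e : E3), (r : E3)⟫_ℝ}) →
      0 ≤ ⟪(a₀ : E3), q₀⟫_ℝ → a₀ ∈ polar R := by
    intro a a₀ ha hap h r hr
    by_cases hre : r = e
    · rw [hre, ← hqe]; exact h
    · have l1 : Filter.Tendsto (fun n => ⟪(a (φ n) : E3), (r : E3)⟫_ℝ) Filter.atTop
          (nhds ⟪(a₀ : E3), (r : E3)⟫_ℝ) := by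
        have hc : Continuous fun w : S2 => ⟪(w : E3), (r : E3)⟫_ℝ := by fun_prop
        exact (hc.tendsto _).comp ha
      have l2 := hεφ.mul_const ⟪(e : E3), (r : E3)⟫_ℝ
      rw [zero_mul] at l2
      refine ge_of_tendsto l1 ((l2.eventually_lt_const (hx r hr hre)).mono fun n hn => ?_)
      refine hap (φ n) r ⟨hr, ?_⟩
      rw [hz]
      simp only [Function.comp_apply] at hn
      linarith
  have hkR : k₀ ∈ polar R := hpol hk0 hk c2.ge
  have hmR : m₀ ∈ polar R := hpol hm0 hm c3
  have hkm0 : ⟪(k₀ : E3), m₀⟫_ℝ = -cos (thickness R) := le_antisymm c1 (hmin k₀ hkR m₀ hmR)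
  rw [hkm0, neg_sq, ← sin_sq, sqrt_sq hS.le, hqe, neg_smul, sub_neg_eq_add] at c4
  have hm' : (m₀ : E3) = sin (thickness R) • (e : E3) - cos (thickness R) • (k₀ : E3) :=
    eq_sub_of_add_eq c4.symm
  rw [hqe] at c2
  have hke : ⟪(e : E3), (k₀ : E3)⟫_ℝ = 0 := by rw [real_inner_comm]; exact c2
  have hnb : ‖cos (thickness R) • (e : E3) + sin (thickness R) • (k₀ : E3)‖ = 1 := by
    rw [← sq_eq_sq₀ (norm_nonneg _) zero_le_one, norm_add_sq_real, real_inner_smul_left,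
      real_inner_smul_right, hke, norm_smul, norm_smul, norm_coe, norm_coe]
    simp
  refine ⟨k₀, norm_coe _, c2, hkR, fun r hr => ?_,
    ⟨cos (thickness R) • (e : E3) + sin (thickness R) • (k₀ : E3), by simpa using hnb⟩, ?_, rfl⟩
  · have := hmR r hr
    rwa [hm', inner_sub_left, real_inner_smul_left, real_inner_smul_left] at this
  · refine hR.1.center_mem hle hkR hmR hkm0 ?_
    rw [hm']
    match_scalars
    · ring
    · linear_combination sin_sq_add_cos_sq (thickness R)

/-! ### The triple product -/

/-- The triple product of three vectors. -/
def vol (a b c : E3) : ℝ :=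
  a 0 * (b 1 * c 2 - b 2 * c 1) - a 1 * (b 0 * c 2 - b 2 * c 0) + a 2 * (b 0 * c 1 - b 1 * c 0)

theorem inner_eq_sum (a b : E3) : ⟪a, b⟫_ℝ = a 0 * b 0 + a 1 * b 1 + a 2 * b 2 := by
  simp [PiLp.inner_apply, Fin.sum_univ_three, mul_comm]

theorem vol_rotate (a b c : E3) : vol a b c = vol b c a := by
  simp only [vol]; ring

theorem vol_swap (a b c : E3) : vol b a c = -vol a b c := by
  simp only [vol]; ring

/-- The product of two triple products is the determinant of the inner products. -/
theorem vol_mul_vol (a b c x y z : E3) : vol a b c * vol x y z =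
    ⟪a, x⟫_ℝ * (⟪b, y⟫_ℝ * ⟪c, z⟫_ℝ - ⟪b, z⟫_ℝ * ⟪c, y⟫_ℝ) -
    ⟪a, y⟫_ℝ * (⟪b, x⟫_ℝ * ⟪c, z⟫_ℝ - ⟪b, z⟫_ℝ * ⟪c, x⟫_ℝ) +
    ⟪a, z⟫_ℝ * (⟪b, x⟫_ℝ * ⟪c, y⟫_ℝ - ⟪b, y⟫_ℝ * ⟪c, x⟫_ℝ) := by
  simp only [vol, inner_eq_sum]; ring

/-- Cramer's rule. -/
theorem vol_mul_inner (a b c x y : E3) : vol a b c * ⟪x, y⟫_ℝ =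
    vol b c x * ⟪a, y⟫_ℝ + vol c a x * ⟪b, y⟫_ℝ + vol a b x * ⟪c, y⟫_ℝ := by
  simp only [vol, inner_eq_sum]; ring

/-- Bessel's inequality for the cross product of a and b against the orthonormal pair x, y. -/
theorem vol_sq_add_vol_sq_le {a b x y : E3} (ha : ⟪a, a⟫_ℝ = 1) (hb : ⟪b, b⟫_ℝ = 1)
    (hx : ⟪x, x⟫_ℝ = 1) (hy : ⟪y, y⟫_ℝ = 1) (hxy : ⟪x, y⟫_ℝ = 0) :
    vol a b x ^ 2 + vol a b y ^ 2 ≤ 1 - ⟪a, b⟫_ℝ ^ 2 := by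
  let n : E3 := !₂[a 1 * b 2 - a 2 * b 1, a 2 * b 0 - a 0 * b 2, a 0 * b 1 - a 1 * b 0]
  have hn : ∀ z : E3, ⟪n, z⟫_ℝ = vol a b z := fun z => by
    simp only [inner_eq_sum, vol, n]; simp; ring
  have hnn : ⟪n, n⟫_ℝ = 1 - ⟪a, b⟫_ℝ ^ 2 := by
    have : ⟪n, n⟫_ℝ = ⟪a, a⟫_ℝ * ⟪b, b⟫_ℝ - ⟪a, b⟫_ℝ ^ 2 := by
      simp only [inner_eq_sum, n]; simp; ring
    rw [this, ha, hb]; ring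
  have hnx := hn x
  have hny := hn y
  set v := vol a b x
  set w := vol a b y
  have h := real_inner_self_nonneg (x := n - v • x - w • y)
  simp only [inner_sub_left, inner_sub_right, real_inner_smul_left, real_inner_smul_right, hnx, hny,
    hx, hy, hxy, real_inner_comm n x, real_inner_comm n y, real_inner_comm x y, hnn] at h
  linarith

/-! ### Two lunes -/

/-- The data of a lune: the center `e` of one of the bounding semicircles, and the center `k` of
the corresponding hemisphere. -/
structure IsLune (e k : E3) : Prop where
  norm_e : ⟪e, e⟫_ℝ = 1
  norm_k : ⟪k, k⟫_ℝ = 1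
  orth : ⟪k, e⟫_ℝ = 0

/-- Membership in the lune bounded by the great circles with normals `k` and `s e - c k`. -/
def MemLune (c s : ℝ) (e k x : E3) : Prop :=
  0 ≤ ⟪k, x⟫_ℝ ∧ 0 ≤ s * ⟪e, x⟫_ℝ - c * ⟪k, x⟫_ℝ

/-- Two lunes each of which contains the two semicircle centers of the other. -/
structure Linked (c s : ℝ) (e k e' k' : E3) : Prop where
  e'_mem : MemLune c s e k e'
  b'_mem : MemLune c s e k (c • e' + s • k')
  e_mem : MemLune c s e' k' e
  b_mem : MemLune c s e' k' (c • e + s • k)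

theorem Linked.symm {c s : ℝ} {e k e' k' : E3} (h : Linked c s e k e' k') :
    Linked c s e' k' e k := ⟨h.e_mem, h.b_mem, h.e'_mem, h.b'_mem⟩

/-- Here L = ⟨e, e'⟩, p = ⟨k, e'⟩, q = ⟨k', e⟩, κ = ⟨k, k'⟩, and y, z are the triple products of e,
e' with k, k'. If Y = -yz were positive, eliminating κ would give qY ≤ Lpz² and pY ≤ Lqy². Together
they give pY ≤ L²pY, hence p = 0, which is impossible as well. -/
theorem mul_nonneg_of_linked_scalars {c s L p q κ y z : ℝ} (hs : 0 < s)
    (hL : L ^ 2 < 1) (hp : 0 ≤ p) (hq : 0 ≤ q) (hy : p ^ 2 + y ^ 2 = 1 - L ^ 2)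
    (hz : q ^ 2 + z ^ 2 = 1 - L ^ 2) (hκ : κ * (1 - L ^ 2) = y * z - L * (p * q))
    (h3 : c * p ≤ s * L) (h4 : c * q ≤ s * L) (h1 : 0 ≤ c * p + s * κ) (h2 : 0 ≤ c * q + s * κ)
    (hL0 : 0 ≤ L) : 0 ≤ y * z := by
  by_contra! hneg
  have hl : 0 < 1 - L ^ 2 := by linarith
  set Y := -(y * z) with hY
  have hY0 : 0 < Y := by linarith
  have i1 : s * (L * (p * q) + Y) ≤ c * p * (1 - L ^ 2) := by
    have := mul_nonneg h1 hl.le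
    nlinarith
  have i2 : s * (L * (p * q) + Y) ≤ c * q * (1 - L ^ 2) := by
    have := mul_nonneg h2 hl.le
    nlinarith
  have j1 : q * Y ≤ L * p * z ^ 2 := by
    have a1 := mul_le_mul_of_nonneg_left i1 hq
    have a2 := mul_le_mul_of_nonneg_left h4 (mul_nonneg hp hl.le)
    have a3 : s * (q * Y) ≤ s * (L * p * z ^ 2) := by
      have : z ^ 2 = 1 - L ^ 2 - q ^ 2 := by linarith
      rw [this]; nlinarith
    exact le_of_mul_le_mul_left a3 hs
  have j2 : p * Y ≤ L * q * y ^ 2 := by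
    have a1 := mul_le_mul_of_nonneg_left i2 hp
    have a2 := mul_le_mul_of_nonneg_left h3 (mul_nonneg hq hl.le)
    have a3 : s * (p * Y) ≤ s * (L * q * y ^ 2) := by
      have : y ^ 2 = 1 - L ^ 2 - p ^ 2 := by linarith
      rw [this]; nlinarith
    exact le_of_mul_le_mul_left a3 hs
  have hYY : Y ^ 2 = y ^ 2 * z ^ 2 := by rw [hY]; ring
  have j3 : q * y ^ 2 ≤ L * p * Y := by
    have := mul_le_mul_of_nonneg_right j1 (sq_nonneg y)
    have h5 : Y * (q * y ^ 2) ≤ Y * (L * p * Y) := by nlinarith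
    exact le_of_mul_le_mul_left h5 hY0
  have j4 : p * (Y * (1 - L ^ 2)) ≤ 0 := by
    have := mul_le_mul_of_nonneg_left j3 hL0
    nlinarith
  have hp0 : p = 0 := by
    by_contra h
    have : 0 < p := lt_of_le_of_ne hp (Ne.symm h)
    have : 0 < p * (Y * (1 - L ^ 2)) := by positivity
    linarith
  rw [hp0] at i1
  nlinarith [mul_pos hs hY0]

/-- Same notation. `hA` places the far semicircle center of the second lune in the first lune.
Eliminating κ from it leaves a convex quadratic in p that must be nonnegative; if L < c², it is
negative at both ends of the interval [0, sL/c] containing p. -/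
theorem sq_le_of_linked_scalars {c s L p q κ y z : ℝ} (hs : 0 < s) (hc : 0 ≤ c)
    (hcs : s ^ 2 + c ^ 2 = 1) (hL : L ^ 2 < 1) (hp : 0 ≤ p) (hq : 0 ≤ q) (hqp : q ≤ p)
    (hy : p ^ 2 + y ^ 2 = 1 - L ^ 2)
    (hz : q ^ 2 + z ^ 2 = 1 - L ^ 2) (hκ : κ * (1 - L ^ 2) = y * z - L * (p * q))
    (h3 : c * p ≤ s * L) (hA : 0 ≤ s * (c * L + s * q) - c * (c * p + s * κ))
    (hL0 : 0 ≤ L) (hyz : 0 ≤ y * z) : c ^ 2 ≤ L := by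
  by_contra! hlt
  have hc0 : 0 < c := lt_of_le_of_ne hc fun h => by rw [← h] at hlt; nlinarith
  have hl : 0 < 1 - L ^ 2 := by linarith
  have hL1 : L < 1 := by nlinarith
  have hyz2 : y ^ 2 ≤ y * z := by
    refine le_of_sq_le_sq ?_ hyz
    nlinarith [sq_nonneg y, mul_nonneg (sq_nonneg y) (show 0 ≤ z ^ 2 - y ^ 2 by nlinarith)]
  -- `hA` times 1 - L², weakened by replacing q by p and yz by y².
  have g : 0 ≤ s * c * (L - 1) * (1 - L ^ 2) + (s ^ 2 - c ^ 2) * (1 - L ^ 2) * p +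
      s * c * (L + 1) * p ^ 2 := by
    have a1 := mul_nonneg hA hl.le
    have a2 : 0 ≤ s ^ 2 * (1 - L ^ 2) * (p - q) := by
      have : 0 ≤ p - q := by linarith
      positivity
    have a3 : 0 ≤ s * c * L * p * (p - q) := by
      have : 0 ≤ p - q := by linarith
      positivity
    have a4 : 0 ≤ s * c * (y * z - y ^ 2) := by
      have : 0 ≤ y * z - y ^ 2 := by linarith
      positivity
    have e' : s * c * y ^ 2 = s * c * (1 - L ^ 2 - p ^ 2) := by
      rw [show y ^ 2 = 1 - L ^ 2 - p ^ 2 by linarith]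
    have e : c * s * (κ * (1 - L ^ 2)) = c * s * (y * z - L * (p * q)) := by rw [hκ]
    nlinarith
  have hg0 : s * c * (L - 1) * (1 - L ^ 2) < 0 := by
    have : 0 < s * c * (1 - L) * (1 - L ^ 2) := by
      have : 0 < 1 - L := by linarith
      positivity
    linarith
  -- The quadratic at p = sL/c, cleared of denominators.
  have gP : c ^ 2 * (s * c * (L - 1) * (1 - L ^ 2)) + c * (s * L) * ((s ^ 2 - c ^ 2) * (1 - L ^ 2))
      + (s * L) ^ 2 * (s * c * (L + 1)) < 0 := by
    have : c ^ 2 * (s * c * (L - 1) * (1 - L ^ 2)) +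
        c * (s * L) * ((s ^ 2 - c ^ 2) * (1 - L ^ 2)) + (s * L) ^ 2 * (s * c * (L + 1)) =
        s * c * (1 + L) * (L * (s ^ 2 + c ^ 2) - c ^ 2) := by ring
    rw [this, hcs]
    have h1 : 0 < s * c * (1 + L) := by positivity
    nlinarith
  have hp0 : 0 < p := lt_of_le_of_ne hp fun h => by
    rw [← h] at g
    linarith
  set g0 := s * c * (L - 1) * (1 - L ^ 2)
  set g1 := (s ^ 2 - c ^ 2) * (1 - L ^ 2)
  have hg2 : 0 ≤ s * c * (L + 1) := by positivity
  set g2 := s * c * (L + 1)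
  have hP : 0 < s * L := lt_of_lt_of_le (by positivity) h3
  set P := s * L
  have h5 : c * g0 + P * g1 + P * g2 * p < 0 := by
    have : c * (c * g0 + P * g1 + P * g2 * p) < 0 := by
      nlinarith [mul_nonneg (mul_nonneg hP.le hg2) (sub_nonneg.2 h3)]
    exact (pos_iff_neg_of_mul_neg this).1 hc0
  have h6 : P * (g0 + g1 * p + g2 * p ^ 2) < 0 := by
    nlinarith [mul_pos_of_neg_of_neg hg0 hg0, mul_nonneg (sub_nonneg.2 h3) (neg_nonneg.2 hg0.le),
      mul_pos hp0 (neg_pos.2 h5)]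
  nlinarith [mul_nonneg hP.le g]

theorem sq_lt_one_of_ne {e e' : E3} (he : ⟪e, e⟫_ℝ = 1) (he' : ⟪e', e'⟫_ℝ = 1) (hne : e ≠ e')
    (h0 : 0 ≤ ⟪e, e'⟫_ℝ) : ⟪e, e'⟫_ℝ ^ 2 < 1 := by
  have : 0 < ⟪e - e', e - e'⟫_ℝ := real_inner_self_pos.2 (sub_ne_zero.2 hne)
  rw [inner_sub_left, inner_sub_right, inner_sub_right, he, he', real_inner_comm e e'] at this
  nlinarith

theorem Linked.inner_nonneg {c s : ℝ} {e k e' k' : E3} (hs : 0 < s) (hc : 0 ≤ c)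
    (h : Linked c s e k e' k') : 0 ≤ ⟪e, e'⟫_ℝ := by
  have h1 := h.e'_mem.1
  have h2 := h.e'_mem.2
  have : 0 ≤ s * ⟪e, e'⟫_ℝ := by nlinarith [mul_nonneg hc h1]
  exact nonneg_of_mul_nonneg_right this hs

/-- The chords joining the semicircle centers of two linked lunes cross each other. -/
theorem Linked.vol_mul_vol_nonneg {c s : ℝ} {e k e' k' : E3} (hs : 0 < s) (hc : 0 ≤ c)
    (hl : IsLune e k) (hl' : IsLune e' k') (h : Linked c s e k e' k') (hne : e ≠ e') :
    0 ≤ vol e e' k * vol e e' k' := by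
  have hL0 := h.inner_nonneg hs hc
  obtain ⟨⟨a1, a2⟩, ⟨a3, a4⟩, ⟨a5, a6⟩, ⟨a7, a8⟩⟩ := h
  simp only [inner_add_right, real_inner_smul_right] at a3 a7
  have y2 := vol_mul_vol e e' k e e' k
  have z2 := vol_mul_vol e e' k' e e' k'
  have yz := vol_mul_vol e e' k e e' k'
  simp only [hl.norm_e, hl.norm_k, hl'.norm_e, hl'.norm_k, real_inner_comm k e,
    real_inner_comm k' e, real_inner_comm k e', real_inner_comm k' e', hl.orth, hl'.orth,
    real_inner_comm e e'] at y2 z2 yz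
  simp only [real_inner_comm e e', real_inner_comm k k'] at *
  refine mul_nonneg_of_linked_scalars (c := c) (κ := ⟪k, k'⟫_ℝ) hs
    (sq_lt_one_of_ne hl.norm_e hl'.norm_e hne hL0) a1 a5 ?_ ?_ ?_ (by linarith) (by linarith)
    (by linarith) (by linarith) hL0
  · linarith
  · linarith
  · linarith

/-- The distance of two distinguished centers is at most `arccos (c ^ 2)`. -/
theorem Linked.sq_le_inner {c s : ℝ} {e k e' k' : E3} (hs : 0 < s) (hc : 0 ≤ c)
    (hcs : s ^ 2 + c ^ 2 = 1)
    (hl : IsLune e k) (hl' : IsLune e' k') (h : Linked c s e k e' k') :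
    c ^ 2 ≤ ⟪e, e'⟫_ℝ := by
  by_cases hne : e = e'
  · rw [← hne, hl.norm_e]; nlinarith
  wlog hqp : ⟪k', e⟫_ℝ ≤ ⟪k, e'⟫_ℝ generalizing e k e' k'
  · rw [real_inner_comm]
    exact this hl' hl h.symm (Ne.symm hne) (le_of_not_ge hqp)
  have hL0 := h.inner_nonneg hs hc
  have hyz := h.vol_mul_vol_nonneg hs hc hl hl' hne
  obtain ⟨⟨a1, a2⟩, ⟨a3, a4⟩, ⟨a5, a6⟩, ⟨a7, a8⟩⟩ := h
  simp only [inner_add_right, real_inner_smul_right] at a3 a7 a4 a8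
  have y2 := vol_mul_vol e e' k e e' k
  have z2 := vol_mul_vol e e' k' e e' k'
  have yz := vol_mul_vol e e' k e e' k'
  simp only [hl.norm_e, hl.norm_k, hl'.norm_e, hl'.norm_k, real_inner_comm k e,
    real_inner_comm k' e, real_inner_comm k e', real_inner_comm k' e', hl.orth, hl'.orth,
    real_inner_comm e e'] at y2 z2 yz a4
  simp only [real_inner_comm e e', real_inner_comm k k'] at *
  refine sq_le_of_linked_scalars (κ := ⟪k, k'⟫_ℝ) (y := vol e e' k) (z := vol e e' k') hs hc hcs
    (sq_lt_one_of_ne hl.norm_e hl'.norm_e hne hL0) a1 a5 hqp ?_ ?_ ?_ (by linarith) ?_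
    hL0 hyz
  · linarith
  · linarith
  · linarith
  · linarith

/-! ### Three lunes -/

/-- The height of a triangle of distinguished centers, if the normal points inside. -/
theorem vol_sq_le_of_inside {c s : ℝ} {e₁ e₂ e₃ k : E3} (hcs : s ^ 2 + c ^ 2 = 1)
    (hc : 0 ≤ c) (h1 : ⟪e₁, e₁⟫_ℝ = 1) (h2 : ⟪e₂, e₂⟫_ℝ = 1) (hl : IsLune e₃ k)
    (hm1 : MemLune c s e₃ k e₁) (hm2 : MemLune c s e₃ k e₂)
    (ha : 0 ≤ vol e₁ e₂ e₃ * vol e₂ e₃ k) (hb : 0 ≤ vol e₁ e₂ e₃ * vol e₃ e₁ k) :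
    vol e₁ e₂ e₃ ^ 2 ≤ s ^ 2 * (1 - ⟪e₁, e₂⟫_ℝ ^ 2) := by
  have hB := vol_sq_add_vol_sq_le h1 h2 hl.norm_e hl.norm_k
    (by rw [real_inner_comm]; exact hl.orth)
  have c1 := vol_mul_inner e₁ e₂ e₃ k e₃
  have c2 := vol_mul_inner e₁ e₂ e₃ k k
  rw [hl.orth, hl.norm_e] at c1
  rw [hl.norm_k, real_inner_comm k e₃, hl.orth] at c2
  have i1 := mul_nonneg ha hm1.2
  have i2 := mul_nonneg hb hm2.2
  rw [real_inner_comm e₁ e₃, real_inner_comm e₁ k] at i1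
  rw [real_inner_comm e₂ e₃, real_inner_comm e₂ k] at i2
  set V := vol e₁ e₂ e₃
  set W := vol e₁ e₂ k
  -- Expand V k in e₁, e₂, e₃ by Cramer's rule. The coefficients of e₁ and e₂ have the sign of V, so
  -- the lune inequalities at e₁ and e₂ may be added with these weights: the path from e₃ along k
  -- crosses the side e₁e₂ before leaving the lune.
  have key : c * V ^ 2 ≤ -(s * (V * W)) := by
    have e1 : 0 = V * (s * (vol e₂ e₃ k * ⟪e₁, e₃⟫_ℝ + vol e₃ e₁ k * ⟪e₂, e₃⟫_ℝ + W)) := by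
      linear_combination (V * s) * c1
    have e2 : c * V ^ 2 = c * V * (vol e₂ e₃ k * ⟪e₁, k⟫_ℝ + vol e₃ e₁ k * ⟪e₂, k⟫_ℝ) := by
      linear_combination (c * V) * c2
    rw [e2]
    nlinarith
  rcases eq_or_ne V 0 with hV | hV
  · rw [hV]
    nlinarith [sq_nonneg s, sq_nonneg V, sq_nonneg W, mul_nonneg (sq_nonneg s)
      (show 0 ≤ 1 - ⟪e₁, e₂⟫_ℝ ^ 2 by nlinarith [sq_nonneg W, sq_nonneg V])]
  · have hV2 : 0 < V ^ 2 := by positivity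
    have h5 : V ^ 2 * (c ^ 2 * V ^ 2) ≤ V ^ 2 * (s ^ 2 * W ^ 2) := by
      have := mul_self_le_mul_self (by positivity : 0 ≤ c * V ^ 2) key
      nlinarith
    have h6 := le_of_mul_le_mul_left h5 hV2
    nlinarith [mul_le_mul_of_nonneg_left hB (sq_nonneg s)]

/-- The height over e₁e₂ is compared with the distance of e₃ from the wall of the lune at e₂, whose
sine is P. `hT` gives V² ≤ P²(1 - A²), and P ≤ s because e₃ is in the lune. -/
theorem height_scalars {c s V u w R P A B L : ℝ} (hc : 0 ≤ c) (hcs : s ^ 2 + c ^ 2 = 1)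
    (hR : 0 ≤ R) (hP : 0 ≤ P) (hcP : c * P ≤ s * L) (hT : R * (1 - L ^ 2) ≤ P * (B - A * L))
    (e1 : u * w = B - R * P - A * L) (e2 : u * u = 1 - A ^ 2 - R ^ 2)
    (e3 : w * w = 1 - L ^ 2 - P ^ 2)
    (e4 : V ^ 2 = 1 + 2 * A * B * L - A ^ 2 - B ^ 2 - L ^ 2) :
    V ^ 2 ≤ s ^ 2 * (1 - A ^ 2) := by
  have hL : P ^ 2 ≤ 1 - L ^ 2 := by nlinarith [mul_self_nonneg w]
  have hA : 0 ≤ 1 - A ^ 2 := by nlinarith [mul_self_nonneg u, sq_nonneg R]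
  have hE : (B - R * P - A * L) ^ 2 = (1 - A ^ 2 - R ^ 2) * (1 - L ^ 2 - P ^ 2) := by
    rw [← e1, ← e2, ← e3]; ring
  have hV : V ^ 2 = R ^ 2 * (1 - L ^ 2) - 2 * (R * (P * (B - A * L))) + P ^ 2 * (1 - A ^ 2) := by
    linear_combination e4 - hE
  have h4 := mul_le_mul_of_nonneg_left hT hR
  have h5 : 0 ≤ R ^ 2 * (1 - L ^ 2) := mul_nonneg (sq_nonneg _) ((sq_nonneg P).trans hL)
  have h6 : V ^ 2 ≤ P ^ 2 * (1 - A ^ 2) := by linarith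
  have h7 : P ^ 2 ≤ s ^ 2 := by
    have h8 := mul_self_le_mul_self (mul_nonneg hc hP) hcP
    have h9 := mul_le_mul_of_nonneg_left hL (sq_nonneg s)
    have h10 : P ^ 2 * (s ^ 2 + c ^ 2) ≤ s ^ 2 := by linarith
    rwa [hcs, mul_one] at h10
  exact h6.trans (mul_le_mul_of_nonneg_right h7 hA)

/-- The height of a triangle of distinguished centers, if the normal at a neighbouring vertex
points outside. -/
theorem vol_sq_le_of_outside {c s : ℝ} {e₁ e₂ e₃ k : E3} (hc : 0 ≤ c)
    (hcs : s ^ 2 + c ^ 2 = 1)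
    (h1 : ⟪e₁, e₁⟫_ℝ = 1) (h3 : ⟪e₃, e₃⟫_ℝ = 1) (hl : IsLune e₂ k)
    (hm1 : MemLune c s e₂ k e₁) (hm3 : MemLune c s e₂ k e₃)
    (ha : vol e₁ e₂ e₃ * vol e₂ e₃ k ≤ 0) :
    vol e₁ e₂ e₃ ^ 2 ≤ s ^ 2 * (1 - ⟪e₁, e₂⟫_ℝ ^ 2) := by
  have v0 := vol_mul_vol e₂ e₃ e₁ e₂ e₃ k
  have v1 := vol_mul_vol e₂ k e₁ e₂ k e₃
  have v2 := vol_mul_vol e₂ k e₁ e₂ k e₁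
  have v3 := vol_mul_vol e₂ k e₃ e₂ k e₃
  have v4 := vol_mul_vol e₁ e₂ e₃ e₁ e₂ e₃
  rw [← vol_rotate] at v0
  have r := hm1.1
  have p := hm3.1
  have p2 := hm3.2
  simp only [h1, h3, hl.norm_e, hl.norm_k, hl.orth, real_inner_comm k e₂, real_inner_comm k e₁,
    real_inner_comm k e₃, real_inner_comm e₁ e₂, real_inner_comm e₁ e₃, real_inner_comm e₂ e₃]
    at v0 v1 v2 v3 v4 r p p2
  refine height_scalars (u := vol e₂ k e₁) (w := vol e₂ k e₃) (R := ⟪k, e₁⟫_ℝ) (P := ⟪k, e₃⟫_ℝ)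
    (B := ⟪e₁, e₃⟫_ℝ) (L := ⟪e₂, e₃⟫_ℝ) hc hcs r p (by linarith) ?_ ?_ ?_ ?_ ?_
  · linarith
  · linarith
  · linarith
  · linarith
  · linarith

/-- All heights of a triangle of distinguished centers of three linked lunes are at most the
thickness of the lunes. -/
theorem vol_sq_le_of_linked {c s : ℝ} {e₁ e₂ e₃ k₁ k₂ k₃ : E3} (hs : 0 < s) (hc : 0 ≤ c)
    (hcs : s ^ 2 + c ^ 2 = 1) (h₁ : IsLune e₁ k₁) (h₂ : IsLune e₂ k₂) (h₃ : IsLune e₃ k₃)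
    (h₁₂ : Linked c s e₁ k₁ e₂ k₂) (h₁₃ : Linked c s e₁ k₁ e₃ k₃) (h₂₃ : Linked c s e₂ k₂ e₃ k₃) :
    vol e₁ e₂ e₃ ^ 2 ≤ s ^ 2 * (1 - ⟪e₁, e₂⟫_ℝ ^ 2) := by
  rcases eq_or_ne (vol e₁ e₂ e₃) 0 with hV | hV
  · have hB := vol_sq_add_vol_sq_le h₁.norm_e h₂.norm_e h₃.norm_e h₃.norm_k
      (by rw [real_inner_comm]; exact h₃.orth)
    rw [hV]
    nlinarith [mul_nonneg (sq_nonneg s) (show 0 ≤ 1 - ⟪e₁, e₂⟫_ℝ ^ 2 by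
      nlinarith [sq_nonneg (vol e₁ e₂ k₃), sq_nonneg (vol e₁ e₂ e₃)])]
  have hne₂₃ : e₂ ≠ e₃ := by rintro rfl; exact hV (by simp only [vol]; ring)
  have hne₁₃ : e₁ ≠ e₃ := by rintro rfl; exact hV (by simp only [vol]; ring)
  -- If the normal at e₃ leaves the triangle across a side, the crossing of the chords makes the
  -- normal at the other end of that side point out as well (weakly).
  have transfer : ∀ {V x y : ℝ}, V * y < 0 → 0 ≤ x * y → V * x ≤ 0 := by
    intro V x y h1 h2
    rcases lt_or_ge 0 (V * x) with h | h
    · have h3 := mul_neg_of_pos_of_neg h h1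
      nlinarith [mul_nonneg (sq_nonneg V) h2]
    · exact h
  rcases lt_or_ge (vol e₁ e₂ e₃ * vol e₂ e₃ k₃) 0 with ha | ha
  · exact vol_sq_le_of_outside hc hcs h₁.norm_e h₃.norm_e h₂ h₁₂.e_mem h₂₃.e'_mem
      (transfer ha (h₂₃.vol_mul_vol_nonneg hs hc h₂ h₃ hne₂₃))
  rcases lt_or_ge (vol e₁ e₂ e₃ * vol e₃ e₁ k₃) 0 with hb | hb
  · have h := vol_sq_le_of_outside (e₁ := e₂) (e₂ := e₁) hc hcs h₂.norm_e h₃.norm_e h₁ h₁₂.e'_mem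
      h₁₃.e'_mem
      (transfer (y := vol e₁ e₃ k₃) (by rw [vol_swap, vol_swap e₃ e₁]; linarith)
        (h₁₃.vol_mul_vol_nonneg hs hc h₁ h₃ hne₁₃))
    rwa [vol_swap, neg_sq, real_inner_comm] at h
  exact vol_sq_le_of_inside hcs hc h₁.norm_e h₂.norm_e h₃ h₁₃.e_mem h₂₃.e_mem ha hb

/-! ### The estimate of the circumradius -/

/-- The circumradius estimate for the extremal right triangle, as an inequality between quadratic
forms. -/
theorem extremal_form_nonneg {C x y z : ℝ} (h0 : 0 ≤ C) (h1 : C ≤ 1) :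
    (1 + C) * (x + y + z) ^ 2 ≤
      (3 - C) * (x ^ 2 + y ^ 2 + z ^ 2 + 2 * (C * (y * z) + C * (x * z) + C ^ 2 * (x * y))) := by
  have key : (3 - C) * (x ^ 2 + y ^ 2 + z ^ 2 + 2 * (C * (y * z) + C * (x * z) + C ^ 2 * (x * y)))
      - (1 + C) * (x + y + z) ^ 2 = (1 - C) * (2 * (z - (1 - C) / 2 * (x + y)) ^ 2 +
        (3 + 2 * C - C ^ 2) / 2 * (x - y) ^ 2) := by ring
  have h2 : 0 ≤ 3 + 2 * C - C ^ 2 := by nlinarith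
  have h3 : 0 ≤ 1 - C := by linarith
  have : 0 ≤ (1 - C) * (2 * (z - (1 - C) / 2 * (x + y)) ^ 2 +
        (3 + 2 * C - C ^ 2) / 2 * (x - y) ^ 2) := by positivity
  linarith

/-- The degenerate triangle in which the vertices with weights y and z coincide; it serves as the
other end of an interpolation with the right triangle. -/
theorem segment_form_nonneg {C x y z : ℝ} (h1 : C ≤ 1) (hx : 0 ≤ x) (hy : 0 ≤ y)
    (hz : 0 ≤ z) : (1 + C) * (x + y + z) ^ 2 ≤
      (3 - C) * (x ^ 2 + y ^ 2 + z ^ 2 + 2 * (1 * (y * z) + C ^ 2 * (x * z) + C ^ 2 * (x * y))) := by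
  have key : (3 - C) * (x ^ 2 + y ^ 2 + z ^ 2 +
      2 * (1 * (y * z) + C ^ 2 * (x * z) + C ^ 2 * (x * y))) - (1 + C) * (x + y + z) ^ 2 =
      (1 - C) * (2 * (x - (y + z)) ^ 2 + 2 * (1 - C) ^ 2 * (x * (y + z))) := by ring
  have h3 : 0 ≤ 1 - C := by linarith
  have : 0 ≤ (1 - C) * (2 * (x - (y + z)) ^ 2 + 2 * (1 - C) ^ 2 * (x * (y + z))) := by positivity
  linarith

/-- Completing the square in z; `h` is the sign of the remaining coefficient of (x + y)². -/
theorem isosceles_form_nonneg {C b c x y z : ℝ} (h1 : C < 1) (hc : c ≤ 1)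
    (h : 2 * C - 2 * (1 + C) * b + (3 - C) * b ^ 2 ≤ (1 - C) * c) :
    (1 + C) * (x + y + z) ^ 2 ≤
      (3 - C) * (x ^ 2 + y ^ 2 + z ^ 2 + 2 * (b * (y * z) + b * (x * z) + c * (x * y))) := by
  have key : 2 * (1 - C) * ((3 - C) * (x ^ 2 + y ^ 2 + z ^ 2 +
      2 * (b * (y * z) + b * (x * z) + c * (x * y))) - (1 + C) * (x + y + z) ^ 2) =
      (2 * (1 - C) * z - ((1 + C) - (3 - C) * b) * (x + y)) ^ 2 +
      (3 - C) * ((1 - C) * c - (2 * C - 2 * (1 + C) * b + (3 - C) * b ^ 2)) * (x + y) ^ 2 +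
      (1 - C) * ((3 - C) * (1 - c)) * (x - y) ^ 2 := by ring
  have h2 : 0 < 1 - C := by linarith
  have h3 : 0 ≤ (1 - C) * c - (2 * C - 2 * (1 + C) * b + (3 - C) * b ^ 2) := by linarith
  have h4 : 0 ≤ 1 - c := by linarith
  have h5 : 0 ≤ 3 - C := by linarith
  have h6 : 0 ≤ 2 * (1 - C) * ((3 - C) * (x ^ 2 + y ^ 2 + z ^ 2 +
      2 * (b * (y * z) + b * (x * z) + c * (x * y))) - (1 + C) * (x + y + z) ^ 2) := by
    rw [key]; positivity
  have := nonneg_of_mul_nonneg_right h6 (by linarith)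
  linarith

/-- The bound for an isosceles triangle whose base angles are acute. -/
theorem isosceles_bound {C b c : ℝ} (hb0 : 0 < b) (hbC : b < C) (hC1 : C < 1)
    (hb : C ^ 2 * (1 + b) ≤ 2 * b ^ 2) (hc : b ^ 2 + √(C ^ 2 - b ^ 2) * √(1 - b ^ 2) ≤ c) :
    2 * C - 2 * (1 + C) * b + (3 - C) * b ^ 2 ≤ (1 - C) * c := by
  -- The cosine of half of the side with cosine b. It rationalizes `hb` to Cx ≤ b.
  set x := √((1 + b) / 2) with hx
  have hx2 : x ^ 2 = (1 + b) / 2 := sq_sqrt (by linarith)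
  have hx0 : 0 < x := sqrt_pos.2 (by linarith)
  have hx1 : x < 1 := by nlinarith
  have hbx : b = 2 * x ^ 2 - 1 := by linarith
  have hCx : C * x ≤ b := by
    refine le_of_sq_le_sq ?_ hb0.le
    rw [mul_pow, hx2]; linarith
  have hxh : 1 / 2 < x ^ 2 := by linarith
  have p1 : x * (C - b) ≤ b * (1 - x) := by nlinarith
  have p2 : (1 - x) * (1 + 2 * x) ≤ x * (1 - C) := by rw [hbx] at hCx; nlinarith
  have p3 : 2 * (1 + x) ≤ x * (1 + 2 * x) ^ 2 := by nlinarith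
  have hpoly : 4 * (C - b) * (1 - b) ≤ (1 - C) ^ 2 * (1 + b) * (C + b) := by
    have q1 : ((1 - x) * (1 + 2 * x)) ^ 2 ≤ (x * (1 - C)) ^ 2 := by
      refine pow_le_pow_left₀ ?_ p2 2
      have : 0 < 1 - x := by linarith
      positivity
    have q2 : x ^ 2 * (4 * (C - b) * (1 - b)) ≤ x * (8 * b * (1 - x) ^ 2 * (1 + x)) := by
      have e : 1 - b = 2 * (1 - x) * (1 + x) := by rw [hbx]; ring
      have : 0 ≤ 8 * x * (1 - x) * (1 + x) := by
        have : 0 < 1 - x := by linarith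
        positivity
      rw [e]
      nlinarith [mul_le_mul_of_nonneg_left p1 this]
    have q3 : x * (8 * b * (1 - x) ^ 2 * (1 + x)) ≤ x ^ 2 * (4 * b * ((1 - x) * (1 + 2 * x)) ^ 2) := by
      have : 0 ≤ 4 * x * b * (1 - x) ^ 2 := by positivity
      nlinarith [mul_le_mul_of_nonneg_left p3 this]
    have q4 : x ^ 2 * (4 * b * ((1 - x) * (1 + 2 * x)) ^ 2) ≤
        x ^ 2 * ((1 - C) ^ 2 * (1 + b) * (C + b)) := by
      refine mul_le_mul_of_nonneg_left ?_ (sq_nonneg x)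
      have e : 1 + b = 2 * x ^ 2 := by linarith
      have e2 : (1 - C) ^ 2 * (1 + b) * (C + b) = 2 * (C + b) * (x * (1 - C)) ^ 2 := by
        rw [e]; ring
      rw [e2]
      have : 4 * b ≤ 2 * (C + b) := by linarith
      have h0 : 0 ≤ ((1 - x) * (1 + 2 * x)) ^ 2 := sq_nonneg _
      nlinarith [mul_le_mul_of_nonneg_left q1 (by linarith : 0 ≤ 2 * (C + b)),
        mul_le_mul_of_nonneg_right this h0]
    exact le_of_mul_le_mul_left (q2.trans (q3.trans q4)) (by positivity)
  have hroot : 2 * (C - b) * (1 - b) ≤ (1 - C) * (√(C ^ 2 - b ^ 2) * √(1 - b ^ 2)) := by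
    refine le_of_sq_le_sq ?_ ?_
    · rw [mul_pow (1 - C), mul_pow √_, sq_sqrt (by nlinarith), sq_sqrt (by nlinarith)]
      have : 0 ≤ (C - b) * (1 - b) := by
        have : 0 < C - b := by linarith
        have : 0 < 1 - b := by linarith
        positivity
      nlinarith [mul_le_mul_of_nonneg_left hpoly this]
    · have : 0 < 1 - C := by linarith
      positivity
  nlinarith [mul_le_mul_of_nonneg_left hc (by linarith : 0 ≤ 1 - C)]

/-- With B = b/C and c ≥ C², the height bound becomes (1 - a²)(1 - B²) ≤ (aB - C)². If a + B < 1 +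
C, then aB - C < (1 - a)(1 - B), which contradicts it. -/
theorem mul_le_of_obtuse {C a b c : ℝ} (hCpos : 0 < C) (hb : b < C) (hb0 : 0 < b) (ha0 : 0 < a)
    (ha1 : a ≤ 1) (hcC : C ^ 2 ≤ c) (hobt : c ≤ a * b)
    (hH : (1 - a ^ 2) * (C ^ 2 - b ^ 2) ≤ (c - a * b) ^ 2) : C * (1 + C - a) ≤ b := by
  set B := b / C with hBd
  have hB : b = C * B := by rw [hBd]; field_simp
  have hB1 : B < 1 := by rw [hBd, div_lt_one hCpos]; exact hb
  have hB0 : 0 < B := by positivity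
  have hsum : 1 + C ≤ a + B := by
    by_contra! hlt
    have h1 : C * ((1 - a ^ 2) * (1 - B ^ 2)) ≤ C * (a * B - C) ^ 2 := by
      have h2 : (c - a * b) ^ 2 ≤ (C * (a * B - C)) ^ 2 := by
        rw [← neg_sq]
        refine pow_le_pow_left₀ (by linarith) ?_ 2
        rw [hB]; nlinarith
      have h3 : C * (C * ((1 - a ^ 2) * (1 - B ^ 2))) ≤ C * (C * (a * B - C) ^ 2) := by
        rw [hB] at hH h2; nlinarith
      exact le_of_mul_le_mul_left h3 hCpos
    have h4 := le_of_mul_le_mul_left h1 hCpos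
    have h5 : 0 ≤ a * B - C := by
      have : 0 ≤ C * (a * B - C) := by rw [hB] at hobt; nlinarith
      exact nonneg_of_mul_nonneg_right this hCpos
    have h6 : a * B - C < (1 - a) * (1 - B) := by nlinarith
    have h7 : (a * B - C) ^ 2 < ((1 - a) * (1 - B)) ^ 2 := pow_lt_pow_left₀ h6 h5 (by norm_num)
    have h8 : ((1 - a) * (1 - B)) ^ 2 ≤ (1 - a ^ 2) * (1 - B ^ 2) := by
      have e1 : 0 ≤ (1 - a) * (1 - B) := mul_nonneg (by linarith) (by linarith)
      have e2 : (1 - a) * (1 - B) ≤ (1 + a) * (1 + B) := by nlinarith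
      nlinarith [mul_le_mul_of_nonneg_left e2 e1]
    linarith
  rw [hB]; exact mul_le_mul_of_nonneg_left (by linarith) hCpos.le

/-- For an acute angle the height bound reads c ≥ ab + √(C² - b²)√(1 - a²); the right side does not
increase when a is replaced by b, which reduces the problem to an isosceles triangle. -/
theorem isosceles_of_acute {C a b c : ℝ} (hb0 : 0 < b) (hb : b < C) (hC1 : C < 1) (hcb : c ≤ b)
    (hba : b ≤ a) (ha1 : a ≤ 1) (hac : a * b < c)
    (hH : (1 - a ^ 2) * (C ^ 2 - b ^ 2) ≤ (c - a * b) ^ 2) :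
    C ^ 2 * (1 + b) ≤ 2 * b ^ 2 ∧ b ^ 2 + √(C ^ 2 - b ^ 2) * √(1 - b ^ 2) ≤ c := by
  have hX : 0 < C ^ 2 - b ^ 2 := by nlinarith
  have hab2 : C ^ 2 * (1 + a) ≤ 2 * b ^ 2 := by
    rcases eq_or_lt_of_le ha1 with h | h
    · rw [h] at hac; linarith
    · have h1 : (c - a * b) ^ 2 ≤ (b - a * b) ^ 2 :=
        pow_le_pow_left₀ (by linarith) (by linarith) 2
      have h2 : (1 - a) * ((1 + a) * (C ^ 2 - b ^ 2)) ≤ (1 - a) * (b ^ 2 * (1 - a)) := by nlinarith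
      have := le_of_mul_le_mul_left h2 (by linarith)
      linarith
  have hb1 : b < 1 := by linarith
  set X := √(C ^ 2 - b ^ 2)
  set Y := √(1 - a ^ 2)
  set Z := √(1 - b ^ 2)
  have hX2 : X ^ 2 = C ^ 2 - b ^ 2 := sq_sqrt hX.le
  have hY2 : Y ^ 2 = 1 - a ^ 2 := sq_sqrt (by nlinarith)
  have hZ2 : Z ^ 2 = 1 - b ^ 2 := sq_sqrt (by nlinarith)
  have hX0 : 0 ≤ X := sqrt_nonneg _
  have hY0 : 0 ≤ Y := sqrt_nonneg _
  have hZ0 : 0 < Z := sqrt_pos.2 (by nlinarith)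
  have h1 : X * Y ≤ c - a * b := by
    refine le_of_sq_le_sq ?_ (by linarith)
    rw [mul_pow, hX2, hY2]; linarith
  have h2 : X * (1 + a) ≤ b * Y := by
    refine le_of_sq_le_sq ?_ (by positivity)
    rw [mul_pow, mul_pow, hX2, hY2]
    nlinarith [mul_le_mul_of_nonneg_left hab2 (by linarith : 0 ≤ 1 + a)]
  have h3 : X * (Z - Y) ≤ b * (a - b) := by
    have h4 : (Z + Y) * (X * (Z - Y)) ≤ (Z + Y) * (b * (a - b)) := by
      have e1 : (Z + Y) * (X * (Z - Y)) = X * (a + b) * (a - b) := by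
        linear_combination X * hZ2 - X * hY2
      have e2 : X * (a + b) ≤ b * (Z + Y) := by nlinarith
      rw [e1]
      nlinarith [mul_le_mul_of_nonneg_right e2 (sub_nonneg.2 hba)]
    exact le_of_mul_le_mul_left h4 (by linarith)
  refine ⟨?_, ?_⟩
  · have := mul_le_mul_of_nonneg_left hba (sq_nonneg C)
    linarith
  · linarith

/-- The circumradius of a spherical triangle with bounded sides and heights, in terms of the cosines
`a ≥ b ≥ c` of its sides. -/
theorem circumradius_form_le {C a b c x y z : ℝ} (hC0 : 0 ≤ C) (hC1 : C < 1) (hcC : C ^ 2 ≤ c)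
    (hcb : c ≤ b) (hba : b ≤ a) (ha1 : a ≤ 1) (hx : 0 ≤ x) (hy : 0 ≤ y) (hz : 0 ≤ z)
    (hD : 1 + 2 * a * b * c - a ^ 2 - b ^ 2 - c ^ 2 ≤ (1 - C ^ 2) * (1 - a ^ 2)) :
    (1 + C) * (x + y + z) ^ 2 ≤
      (3 - C) * (x ^ 2 + y ^ 2 + z ^ 2 + 2 * (a * (y * z) + b * (x * z) + c * (x * y))) := by
  have hyz := mul_nonneg hy hz
  have hxz := mul_nonneg hx hz
  have hxy := mul_nonneg hx hy
  have h3C : 0 ≤ 3 - C := by linarith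
  have mono : ∀ {a' b' c' : ℝ}, a' ≤ a → b' ≤ b → c' ≤ c → (1 + C) * (x + y + z) ^ 2 ≤
      (3 - C) * (x ^ 2 + y ^ 2 + z ^ 2 + 2 * (a' * (y * z) + b' * (x * z) + c' * (x * y))) →
      (1 + C) * (x + y + z) ^ 2 ≤
      (3 - C) * (x ^ 2 + y ^ 2 + z ^ 2 + 2 * (a * (y * z) + b * (x * z) + c * (x * y))) := by
    intro a' b' c' h1 h2 h3 h
    refine h.trans (mul_le_mul_of_nonneg_left ?_ h3C)
    have := mul_le_mul_of_nonneg_right h1 hyz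
    have := mul_le_mul_of_nonneg_right h2 hxz
    have := mul_le_mul_of_nonneg_right h3 hxy
    linarith
  -- The form grows with each cosine, so it suffices to find a smaller triple for which the bound is
  -- known; here it is (C, C, C²).
  rcases le_or_gt C b with hb | hb
  · exact mono (hb.trans hba) hb hcC (extremal_form_nonneg hC0 hC1.le)
  have hCpos : 0 < C := lt_of_le_of_ne hC0 fun h => by rw [← h] at hcC hb; linarith
  have hb0 : 0 < b := by nlinarith [pow_pos hCpos 2]
  have ha0 : 0 < a := by linarith
  have hH : (1 - a ^ 2) * (C ^ 2 - b ^ 2) ≤ (c - a * b) ^ 2 := by nlinarith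
  -- The sign of c - ab tells whether the angle opposite the longest side is acute.
  rcases le_or_gt c (a * b) with hobt | hac
  · have hsum := mul_le_of_obtuse hCpos hb hb0 ha0 ha1 hcC hobt hH
    have haC : C ≤ a := by nlinarith
    have h1C : 0 < 1 - C := by linarith
    have s1 := segment_form_nonneg (x := x) (y := y) (z := z) hC1.le hx hy hz
    have s0 := extremal_form_nonneg (x := x) (y := y) (z := z) hC0 hC1.le
    -- The point with first coordinate a on the segment from (C, C, C²) to (1, C², C²).
    refine mono (a' := a) (b' := C * (1 + C - a)) (c' := C ^ 2) le_rfl ?_ hcC ?_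
    · linarith
    · have t1 := mul_le_mul_of_nonneg_left s1 (by linarith : 0 ≤ a - C)
      have t0 := mul_le_mul_of_nonneg_left s0 (by linarith : 0 ≤ 1 - a)
      refine le_of_mul_le_mul_left ?_ h1C
      linear_combination t1 + t0
  · obtain ⟨h1, h2⟩ := isosceles_of_acute hb0 hb hC1 hcb hba ha1 hac hH
    exact mono hba le_rfl le_rfl (isosceles_form_nonneg hC1 (by linarith)
      (isosceles_bound hb0 hb hC1 h1 h2))

/-! ### The covering disk of a reduced body -/

theorem cos_sq_arctan_radius {δ : ℝ} (h0 : 0 < δ) (h1 : δ ≤ π / 2) :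
    cos (arctan (√2 * tan (δ / 2))) ^ 2 = (1 + cos δ) / (3 - cos δ) := by
  have hc : 0 < cos (δ / 2) := cos_pos_of_mem_Ioo ⟨by linarith, by linarith⟩
  have hcos : cos δ = 2 * cos (δ / 2) ^ 2 - 1 := by
    rw [← cos_two_mul]; congr 1; ring
  have hs := sin_sq_add_cos_sq (δ / 2)
  have h3 : 0 < 3 - cos δ := by linarith [cos_le_one δ]
  rw [cos_sq_arctan, mul_pow, sq_sqrt (by norm_num), tan_eq_sin_div_cos, div_pow, hcos,
    show sin (δ / 2) ^ 2 = 1 - cos (δ / 2) ^ 2 by linarith]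
  rw [hcos] at h3
  generalize cos (δ / 2) = y at *
  have h4 : 0 < 2 - y ^ 2 := by linarith
  have e1 : 1 + 2 * ((1 - y ^ 2) / y ^ 2) = (2 - y ^ 2) / y ^ 2 := by field_simp; ring
  rw [e1, one_div_div, div_eq_div_iff h4.ne' h3.ne']
  ring

/-- The point of least norm of the convex hull of a convex body is a convex combination of three
points of the body at the same distance from it. -/
theorem IsConvexBody.exists_circumcenter {R : Set S2} (hR : IsConvexBody R) :
    ∃ (x : E3) (e : Fin 3 → S2) (w : Fin 3 → ℝ), x ≠ 0 ∧ (∀ r ∈ R, ‖x‖ ^ 2 ≤ ⟪x, (r : E3)⟫_ℝ) ∧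
      (∀ i, e i ∈ R ∧ ⟪x, (e i : E3)⟫_ℝ = ‖x‖ ^ 2) ∧ (∀ i, 0 ≤ w i) ∧ ∑ i, w i = 1 ∧
      ∑ i, w i • (e i : E3) = x := by
  set K := convexHull ℝ ((fun p : S2 => (p : E3)) '' R) with hK
  have hKc : IsCompact K := isCompact_convexHull_coe hR.1
  have hne : K.Nonempty := by
    obtain ⟨p, hp⟩ := hR.2.2
    exact ⟨p, subset_convexHull ℝ _ ⟨p, interior_subset hp, rfl⟩⟩
  obtain ⟨x, hxK, hx⟩ := exists_norm_eq_iInf_of_complete_convex hne hKc.isComplete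
    (convex_convexHull ℝ _) 0
  rw [norm_eq_iInf_iff_real_inner_le_zero (convex_convexHull ℝ _) hxK] at hx
  have hvar : ∀ y ∈ K, ‖x‖ ^ 2 ≤ ⟪x, y⟫_ℝ := fun y hy => by
    have := hx y hy
    rw [zero_sub, inner_neg_left, inner_sub_right, real_inner_self_eq_norm_sq] at this
    linarith
  have hx0 : x ≠ 0 := fun h =>
    zero_notMem_openCone R (h ▸ convexHull_subset_openCone hR.2.1 hxK)
  obtain ⟨ι, _, z, w, hz, hind, hw, hsum, hcomb⟩ := eq_pos_convex_span_of_mem_convexHull hxK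
  have hne : Nonempty ι := by
    by_contra h
    rw [not_nonempty_iff] at h
    simp at hsum
  have hxz : ∀ i, ⟪x, z i⟫_ℝ = ‖x‖ ^ 2 := by
    have h1 : ∑ i, w i * (⟪x, z i⟫_ℝ - ‖x‖ ^ 2) = 0 := by
      have h2 : ⟪x, ∑ i, w i • z i⟫_ℝ = ∑ i, w i * ⟪x, z i⟫_ℝ := by
        rw [inner_sum]; simp only [real_inner_smul_right]
      rw [hcomb, real_inner_self_eq_norm_sq] at h2
      simp only [mul_sub, Finset.sum_sub_distrib, ← Finset.sum_mul, hsum, ← h2]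
      ring
    have h3 := (Finset.sum_eq_zero_iff_of_nonneg fun i _ => mul_nonneg (hw i).le
      (sub_nonneg.2 (hvar _ (subset_convexHull ℝ _ (hz ⟨i, rfl⟩))))).1 h1
    intro i
    have := (mul_eq_zero.1 (h3 i (Finset.mem_univ i))).resolve_left (hw i).ne'
    linarith
  have hpos : 0 < ‖x‖ ^ 2 := by have := norm_pos_iff.2 hx0; positivity
  -- Affinely independent points of a plane missing the origin are linearly independent, so there
  -- are at most three, one fewer than Carathéodory's bound.
  have hlin : LinearIndependent ℝ z := by
    rw [Fintype.linearIndependent_iff]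
    intro g hg
    have h1 : ∑ i, g i = 0 := by
      have h2 : ⟪x, ∑ i, g i • z i⟫_ℝ = (∑ i, g i) * ‖x‖ ^ 2 := by
        rw [inner_sum, Finset.sum_mul]; simp only [real_inner_smul_right, hxz]
      rw [hg, inner_zero_right] at h2
      exact (mul_eq_zero.1 h2.symm).resolve_right hpos.ne'
    have := (affineIndependent_iff.1 hind) Finset.univ g h1 hg
    exact fun i => this i (Finset.mem_univ i)
  have hcard : Fintype.card ι ≤ 3 := by
    have := hlin.fintype_card_le_finrank
    simpa using this
  obtain ⟨z', w', h1, h2, h3, h4⟩ := exists_fin_convex_combination hcard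
    (s := {y : E3 | ∃ r ∈ R, (r : E3) = y ∧ ⟪x, y⟫_ℝ = ‖x‖ ^ 2}) (z := z) (w := w)
    (fun i => by
      obtain ⟨r, hr, hrz⟩ := hz ⟨i, rfl⟩
      exact ⟨r, hr, hrz, hxz i⟩) (fun i => (hw i).le)
  choose e he1 he2 he3 using h1
  refine ⟨x, e, w', hx0, fun r hr => hvar _ (subset_convexHull ℝ _ ⟨r, hr, rfl⟩),
    fun i => ⟨he1 i, by rw [he2]; exact he3 i⟩, h2, h3.trans hsum, ?_⟩
  simp only [he2]
  exact h4.trans hcomb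

/-- The inequality for three linked lunes, without any assumption on the order of the sides. -/
theorem norm_sq_ge_of_linked {c s : ℝ} (hs : 0 < s) (hc : 0 ≤ c) (hcs : s ^ 2 + c ^ 2 = 1)
    {e k : Fin 3 → E3} (hl : ∀ i, IsLune (e i) (k i))
    (hL : ∀ i j, Linked c s (e i) (k i) (e j) (k j)) {w : Fin 3 → ℝ} (hw : ∀ i, 0 ≤ w i)
    (hsum : ∑ i, w i = 1) : 1 + c ≤ (3 - c) * ‖∑ i, w i • e i‖ ^ 2 := by
  have hc1 : c < 1 := by nlinarith
  have main : ∀ i₁ i₂ i₃ : Fin 3, ⟪e i₁, e i₂⟫_ℝ ≤ ⟪e i₁, e i₃⟫_ℝ → ⟪e i₁, e i₃⟫_ℝ ≤ ⟪e i₂, e i₃⟫_ℝ →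
      (1 + c) * (w i₁ + w i₂ + w i₃) ^ 2 ≤ (3 - c) * (w i₁ ^ 2 + w i₂ ^ 2 + w i₃ ^ 2 +
        2 * (⟪e i₂, e i₃⟫_ℝ * (w i₂ * w i₃) + ⟪e i₁, e i₃⟫_ℝ * (w i₁ * w i₃) +
        ⟪e i₁, e i₂⟫_ℝ * (w i₁ * w i₂))) := by
    intro i₁ i₂ i₃ h1 h2
    have hn : ∀ i, ‖e i‖ = 1 := fun i => by
      have := (hl i).norm_e
      rw [real_inner_self_eq_norm_sq] at this
      nlinarith [norm_nonneg (e i)]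
    have ha1 : ⟪e i₂, e i₃⟫_ℝ ≤ 1 := by
      simpa [hn] using real_inner_le_norm (e i₂) (e i₃)
    refine circumradius_form_le hc hc1 ((hL i₁ i₂).sq_le_inner hs hc hcs (hl i₁) (hl i₂)) h1 h2 ha1
      (hw _) (hw _) (hw _) ?_
    have hv := vol_sq_le_of_linked hs hc hcs (hl i₂) (hl i₃) (hl i₁) (hL i₂ i₃) (hL i₂ i₁) (hL i₃ i₁)
    have hg := vol_mul_vol (e i₂) (e i₃) (e i₁) (e i₂) (e i₃) (e i₁)
    rw [(hl i₁).norm_e, (hl i₂).norm_e, (hl i₃).norm_e, real_inner_comm (e i₁) (e i₂),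
      real_inner_comm (e i₁) (e i₃), real_inner_comm (e i₂) (e i₃)] at hg
    have hs2 : s ^ 2 = 1 - c ^ 2 := by linarith
    rw [hs2] at hv
    linarith
  have hQ : ‖∑ i, w i • e i‖ ^ 2 = w 0 ^ 2 + w 1 ^ 2 + w 2 ^ 2 +
      2 * (⟪e 1, e 2⟫_ℝ * (w 1 * w 2) + ⟪e 0, e 2⟫_ℝ * (w 0 * w 2) +
      ⟪e 0, e 1⟫_ℝ * (w 0 * w 1)) := by
    rw [← real_inner_self_eq_norm_sq, Fin.sum_univ_three]
    simp only [inner_add_left, inner_add_right, real_inner_smul_left, real_inner_smul_right,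
      (hl _).norm_e, real_inner_comm (e 0) (e 1), real_inner_comm (e 0) (e 2),
      real_inner_comm (e 1) (e 2)]
    ring
  have hσ : (w 0 + w 1 + w 2) ^ 2 = 1 := by
    rw [Fin.sum_univ_three] at hsum; rw [hsum]; norm_num
  have c01 := real_inner_comm (e 0) (e 1)
  have c02 := real_inner_comm (e 0) (e 2)
  have c12 := real_inner_comm (e 1) (e 2)
  have m1 := main 0 1 2
  have m2 := main 1 0 2
  have m3 := main 0 2 1
  have m4 := main 2 0 1
  have m5 := main 1 2 0
  have m6 := main 2 1 0
  rw [c01, c02, c12] at *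
  have fin : ∀ y, (1 + c) * (w 0 + w 1 + w 2) ^ 2 ≤ y → 1 + c ≤ y := fun y hy => by
    rwa [hσ, mul_one] at hy
  rw [hQ]
  refine fin _ ?_
  rcases le_total ⟪e 0, e 1⟫_ℝ ⟪e 0, e 2⟫_ℝ with h1 | h1 <;>
    rcases le_total ⟪e 0, e 2⟫_ℝ ⟪e 1, e 2⟫_ℝ with h2 | h2 <;>
    rcases le_total ⟪e 0, e 1⟫_ℝ ⟪e 1, e 2⟫_ℝ with h3 | h3
  · linarith [m1 h1 h2]
  · linarith [m1 h1 h2]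
  · linarith [m2 h3 h2]
  · linarith [m5 h3 h1]
  · linarith [m3 h1 h3]
  · linarith [m4 h2 h3]
  · linarith [m2 h3 (by linarith)]
  · linarith [m6 h2 h1]

theorem IsReduced.exists_covering_disk {R : Set S2} (hR : IsReduced R) (hle : thickness R ≤ π / 2) :
    ∃ c : S2, R ⊆ disk c (arctan (√2 * tan (thickness R / 2))) := by
  obtain ⟨h0, hπ, -, -⟩ := hR.1.exists_diametral
  have hS : 0 < sin (thickness R) := sin_pos_of_pos_of_lt_pi h0 hπ
  have hc : 0 ≤ cos (thickness R) := cos_nonneg_of_neg_pi_div_two_le_of_le (by linarith) hle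
  obtain ⟨x, e, w, hx0, hxR, he, hw, hsum, hcomb⟩ := hR.1.exists_circumcenter
  have hn := norm_pos_iff.2 hx0
  have hx1 : ‖x‖ ≤ 1 := by
    have h1 := (he 0).2
    have h2 := real_inner_le_norm x (e 0 : E3)
    rw [h1, norm_coe] at h2
    nlinarith
  have hκ : 1 + cos (thickness R) ≤ (3 - cos (thickness R)) * ‖x‖ ^ 2 := by
    rcases eq_or_lt_of_le hx1 with h | h
    · rw [h]; linarith [cos_le_one (thickness R)]
    -- On R this functional is at least ‖x‖²(1 - ⟨e i, r⟩), so it exposes e i; it is nonzero because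
    -- ‖x‖ < 1.
    have hexp : ∀ i, _ := fun i => hR.exists_lune_of_exposed hle (x := x - ‖x‖ ^ 2 • (e i : E3))
      (he i).1 (by
        intro h'
        have h2 := congrArg norm (sub_eq_zero.1 h')
        rw [norm_smul, norm_coe, norm_of_nonneg (sq_nonneg _)] at h2
        nlinarith) (by
        rw [inner_sub_left, real_inner_smul_left, inner_coe_self, (he i).2]; ring) (by
        intro r hr hne
        rw [inner_sub_left, real_inner_smul_left]
        have h2 := hxR r hr
        have h3 : ⟪(e i : E3), r⟫_ℝ < 1 := inner_coe_lt_one (Ne.symm hne)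
        nlinarith [pow_pos hn 2])
    choose k hk1 hk2 hk3 hk4 b hb1 hb2 using hexp
    rw [← hcomb]
    have hmem : ∀ i, ∀ r ∈ R, MemLune (cos (thickness R)) (sin (thickness R)) (e i) (k i) r :=
      fun i r hr => ⟨hk3 i r hr, hk4 i r hr⟩
    refine norm_sq_ge_of_linked (e := fun i => (e i : E3)) (k := k) hS hc (sin_sq_add_cos_sq _)
      (fun i => ⟨inner_coe_self _, by rw [real_inner_self_eq_norm_sq, hk1]; norm_num, hk2 i⟩)
      (fun i j => ⟨hmem i _ (he j).1, ?_, hmem j _ (he i).1, ?_⟩) hw hsum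
    · rw [← hb2]; exact hmem i _ (hb1 j)
    · rw [← hb2]; exact hmem j _ (hb1 i)
  refine ⟨unitVec x hx0, fun r hr => ?_⟩
  have hcos := cos_sq_arctan_radius h0 hle
  have htan : 0 ≤ arctan (√2 * tan (thickness R / 2)) := by
    rw [arctan_nonneg]
    exact mul_nonneg (sqrt_nonneg _)
      (tan_nonneg_of_nonneg_of_le_pi_div_two (by linarith) (by linarith))
  have hle' : arctan (√2 * tan (thickness R / 2)) ≤ π := by
    linarith [arctan_lt_pi_div_two (√2 * tan (thickness R / 2)), pi_pos]
  show sdist _ _ ≤ _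
  rw [sdist_eq_arccos, ← arccos_cos htan hle']
  refine arccos_le_arccos ?_
  have h1 : cos (arctan (√2 * tan (thickness R / 2))) ≤ ‖x‖ := by
    refine le_of_sq_le_sq ?_ hn.le
    rw [hcos, div_le_iff₀ (by linarith [cos_le_one (thickness R)])]
    linarith
  refine h1.trans ?_
  rw [inner_unitVec, le_inv_mul_iff₀ hn, ← sq]
  exact hxR r hr

/-! ### Coordinates with respect to an orthonormal frame -/

/-- Three pairwise orthogonal points of the sphere. -/
structure IsFrame (o u v : S2) : Prop where
  ou : ⟪(o : E3), u⟫_ℝ = 0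
  ov : ⟪(o : E3), v⟫_ℝ = 0
  uv : ⟪(u : E3), v⟫_ℝ = 0

section Frame

variable {o u v : S2}

theorem IsFrame.uo (h : IsFrame o u v) : ⟪(u : E3), o⟫_ℝ = 0 := by rw [real_inner_comm, h.ou]
theorem IsFrame.vo (h : IsFrame o u v) : ⟪(v : E3), o⟫_ℝ = 0 := by rw [real_inner_comm, h.ov]
theorem IsFrame.vu (h : IsFrame o u v) : ⟪(v : E3), u⟫_ℝ = 0 := by rw [real_inner_comm, h.uv]

theorem IsFrame.of_sdist (h₁ : sdist o u = π / 2) (h₂ : sdist o v = π / 2)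
    (h₃ : sdist u v = π / 2) : IsFrame o u v := by
  refine ⟨?_, ?_, ?_⟩
  · rw [← cos_sdist, h₁, cos_pi_div_two]
  · rw [← cos_sdist, h₂, cos_pi_div_two]
  · rw [← cos_sdist, h₃, cos_pi_div_two]

theorem IsFrame.expand (h : IsFrame o u v) (p : E3) :
    p = ⟪(o : E3), p⟫_ℝ • (o : E3) + ⟪(u : E3), p⟫_ℝ • (u : E3) + ⟪(v : E3), p⟫_ℝ • (v : E3) := by
  set w : E3 := p - (⟪(o : E3), p⟫_ℝ • (o : E3) + ⟪(u : E3), p⟫_ℝ • (u : E3) +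
    ⟪(v : E3), p⟫_ℝ • (v : E3)) with hw
  have h1 : ⟪(o : E3), w⟫_ℝ = 0 := by
    simp only [hw, inner_sub_right, inner_add_right, real_inner_smul_right, inner_coe_self, h.ou, h.ov]
    ring
  have h2 : ⟪(u : E3), w⟫_ℝ = 0 := by
    simp only [hw, inner_sub_right, inner_add_right, real_inner_smul_right, inner_coe_self, h.uo, h.uv]
    ring
  have h3 : ⟪(v : E3), w⟫_ℝ = 0 := by
    simp only [hw, inner_sub_right, inner_add_right, real_inner_smul_right, inner_coe_self, h.vo, h.vu]
    ring
  have hV := vol_mul_vol (o : E3) u v o u v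
  simp only [inner_coe_self, h.ou, h.ov, h.uv, h.uo, h.vo, h.vu] at hV
  have hc := vol_mul_inner (o : E3) u v w w
  rw [h1, h2, h3] at hc
  have hV0 : vol (o : E3) u v ≠ 0 := by rintro h0; rw [h0] at hV; norm_num at hV
  have hww : ⟪w, w⟫_ℝ = 0 := (mul_eq_zero.1 (by linarith)).resolve_left hV0
  exact sub_eq_zero.1 (inner_self_eq_zero.1 hww)

theorem IsFrame.inner_eq (h : IsFrame o u v) (p q : E3) :
    ⟪p, q⟫_ℝ = ⟪(o : E3), p⟫_ℝ * ⟪(o : E3), q⟫_ℝ + ⟪(u : E3), p⟫_ℝ * ⟪(u : E3), q⟫_ℝ +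
      ⟪(v : E3), p⟫_ℝ * ⟪(v : E3), q⟫_ℝ := by
  conv_lhs => rw [h.expand p]
  simp only [inner_add_left, real_inner_smul_left]

theorem IsFrame.sum_sq (h : IsFrame o u v) (p : S2) :
    ⟪(o : E3), p⟫_ℝ ^ 2 + ⟪(u : E3), p⟫_ℝ ^ 2 + ⟪(v : E3), p⟫_ℝ ^ 2 = 1 := by
  have := h.inner_eq p p
  rw [inner_coe_self] at this
  linarith

/-- The point with given coordinates. -/
theorem IsFrame.exists_point (h : IsFrame o u v) {z x y : ℝ} (hz : z ^ 2 + x ^ 2 + y ^ 2 = 1) :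
    ∃ p : S2, (p : E3) = z • (o : E3) + x • (u : E3) + y • (v : E3) ∧ ⟪(o : E3), p⟫_ℝ = z ∧
      ⟪(u : E3), p⟫_ℝ = x ∧ ⟪(v : E3), p⟫_ℝ = y := by
  set w : E3 := z • (o : E3) + x • (u : E3) + y • (v : E3) with hw
  have h1 : ⟪(o : E3), w⟫_ℝ = z := by
    simp only [hw, inner_add_right, real_inner_smul_right, inner_coe_self, h.ou, h.ov]
    ring
  have h2 : ⟪(u : E3), w⟫_ℝ = x := by
    simp only [hw, inner_add_right, real_inner_smul_right, inner_coe_self, h.uo, h.uv]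
    ring
  have h3 : ⟪(v : E3), w⟫_ℝ = y := by
    simp only [hw, inner_add_right, real_inner_smul_right, inner_coe_self, h.vo, h.vu]
    ring
  have hn : ‖w‖ = 1 := by
    rw [← sq_eq_sq₀ (norm_nonneg _) zero_le_one, ← real_inner_self_eq_norm_sq, h.inner_eq, h1, h2, h3]
    linarith
  exact ⟨⟨w, by simpa using hn⟩, rfl, h1, h2, h3⟩

theorem IsFrame.ext (h : IsFrame o u v) {p q : S2} (h0 : ⟪(o : E3), p⟫_ℝ = ⟪(o : E3), q⟫_ℝ)
    (h1 : ⟪(u : E3), p⟫_ℝ = ⟪(u : E3), q⟫_ℝ) (h2 : ⟪(v : E3), p⟫_ℝ = ⟪(v : E3), q⟫_ℝ) : p = q := by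
  ext1
  rw [h.expand p, h.expand q, h0, h1, h2]

/-! ### Quarters of disks -/

theorem mem_disk_iff {c p : S2} {ρ : ℝ} (h0 : 0 ≤ ρ) (h1 : ρ ≤ π) :
    p ∈ disk c ρ ↔ cos ρ ≤ ⟪(c : E3), p⟫_ℝ := by
  have hm : sdist c p ∈ Icc 0 π :=
    ⟨InnerProductGeometry.angle_nonneg _ _, InnerProductGeometry.angle_le_pi _ _⟩
  rw [← cos_sdist, strictAntiOn_cos.le_iff_ge ⟨h0, h1⟩ hm]
  rfl

theorem mem_quarterDisk_iff {δ : ℝ} (h0 : 0 ≤ δ) (h1 : δ ≤ π) {p : S2} :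
    p ∈ quarterDisk o u v δ ↔
      cos δ ≤ ⟪(o : E3), p⟫_ℝ ∧ 0 ≤ ⟪(u : E3), p⟫_ℝ ∧ 0 ≤ ⟪(v : E3), p⟫_ℝ := by
  rw [quarterDisk, mem_inter_iff, mem_inter_iff, mem_disk_iff h0 h1, mem_hemisphere,
    mem_hemisphere, and_assoc]

variable {δ : ℝ}

theorem IsFrame.isConvexBody_quarterDisk (h : IsFrame o u v) (h0 : 0 < δ) (h1 : δ ≤ π / 2) :
    IsConvexBody (quarterDisk o u v δ) := by
  have hπ : δ ≤ π := by linarith [pi_pos]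
  have hC : 0 ≤ cos δ := cos_nonneg_of_neg_pi_div_two_le_of_le (by linarith) h1
  refine ⟨?_, ⟨?_, ?_⟩, ?_⟩
  · have : quarterDisk o u v δ = {p : S2 | cos δ ≤ ⟪(o : E3), p⟫_ℝ} ∩
        ({p : S2 | 0 ≤ ⟪(u : E3), p⟫_ℝ} ∩ {p : S2 | 0 ≤ ⟪(v : E3), p⟫_ℝ}) := by
      ext p; exact mem_quarterDisk_iff h0.le hπ
    rw [this]
    exact (isClosed_le continuous_const (continuous_inner_coe _)).inter
      ((isClosed_le continuous_const (continuous_inner_coe _)).inter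
      (isClosed_le continuous_const (continuous_inner_coe _)))
  · intro a ha hna
    rw [mem_quarterDisk_iff h0.le hπ] at ha hna
    rw [show ((-a : S2) : E3) = -(a : E3) from rfl] at hna
    simp only [inner_neg_right] at hna
    have h2 := h.sum_sq a
    have e0 : ⟪(o : E3), a⟫_ℝ = 0 := by linarith [ha.1, hna.1]
    have e1 : ⟪(u : E3), a⟫_ℝ = 0 := by linarith [ha.2.1, hna.2.1]
    have e2 : ⟪(v : E3), a⟫_ℝ = 0 := by linarith [ha.2.2, hna.2.2]
    rw [e0, e1, e2] at h2
    norm_num at h2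
  · rintro a ha b hb p ⟨s, t, hs, ht, hp⟩
    rw [mem_quarterDisk_iff h0.le hπ] at ha hb ⊢
    have hst : 1 ≤ s + t := by
      have h2 := norm_add_le (s • (a : E3)) (t • (b : E3))
      rw [← hp, norm_smul, norm_smul, norm_coe, norm_coe, norm_coe, norm_of_nonneg hs,
        norm_of_nonneg ht] at h2
      linarith
    simp only [hp, inner_add_right, real_inner_smul_right]
    refine ⟨?_, ?_, ?_⟩
    · nlinarith [mul_le_mul_of_nonneg_left ha.1 hs, mul_le_mul_of_nonneg_left hb.1 ht]
    · exact add_nonneg (mul_nonneg hs ha.2.1) (mul_nonneg ht hb.2.1)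
    · exact add_nonneg (mul_nonneg hs ha.2.2) (mul_nonneg ht hb.2.2)
  · have hs : 0 < sin (δ / 2) := sin_pos_of_pos_of_lt_pi (by linarith) (by linarith)
    have hsq : (√2) ^ 2 = 2 := sq_sqrt (by norm_num)
    obtain ⟨p, -, p0, p1, p2⟩ := h.exists_point (z := cos (δ / 2)) (x := sin (δ / 2) / √2)
      (y := sin (δ / 2) / √2) (by
        rw [div_pow, hsq]; linarith [sin_sq_add_cos_sq (δ / 2)])
    refine ⟨p, mem_interior.2 ⟨{p : S2 | cos δ < ⟪(o : E3), p⟫_ℝ} ∩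
        ({p : S2 | 0 < ⟪(u : E3), p⟫_ℝ} ∩ {p : S2 | 0 < ⟪(v : E3), p⟫_ℝ}), ?_, ?_, ?_, ?_, ?_⟩⟩
    · rintro q ⟨q0, q1, q2⟩
      exact (mem_quarterDisk_iff h0.le hπ).2 ⟨le_of_lt q0, le_of_lt q1, le_of_lt q2⟩
    · exact (isOpen_lt continuous_const (continuous_inner_coe _)).inter
        ((isOpen_lt continuous_const (continuous_inner_coe _)).inter
        (isOpen_lt continuous_const (continuous_inner_coe _)))
    · simp only [mem_ofPred_eq]
      rw [p0]
      exact cos_lt_cos_of_nonneg_of_le_pi (by linarith) hπ (by linarith)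
    · simp only [mem_ofPred_eq]; rw [p1]; positivity
    · simp only [mem_ofPred_eq]; rw [p2]; positivity

/-- The tangent great circle of the disk at a point of its boundary arc. -/
theorem IsFrame.tangent_nonneg (h : IsFrame o u v) (h0 : 0 < δ) (h1 : δ ≤ π / 2) {a b : ℝ}
    (hab : a ^ 2 + b ^ 2 = 1) {p : S2} (hp : p ∈ quarterDisk o u v δ) :
    a * ⟪(u : E3), p⟫_ℝ + b * ⟪(v : E3), p⟫_ℝ ≤ sin δ ∧
    0 ≤ sin δ * ⟪(o : E3), p⟫_ℝ - cos δ * (a * ⟪(u : E3), p⟫_ℝ + b * ⟪(v : E3), p⟫_ℝ) := by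
  have hπ : δ ≤ π := by linarith [pi_pos]
  have hC : 0 ≤ cos δ := cos_nonneg_of_neg_pi_div_two_le_of_le (by linarith) h1
  have hS : 0 < sin δ := sin_pos_of_pos_of_lt_pi h0 (by linarith [pi_pos])
  have hs := h.sum_sq p
  rw [mem_quarterDisk_iff h0.le hπ] at hp
  obtain ⟨p0, p1, p2⟩ := hp
  have hcs := sin_sq_add_cos_sq δ
  set z := ⟪(o : E3), p⟫_ℝ
  set x := ⟪(u : E3), p⟫_ℝ
  set y := ⟪(v : E3), p⟫_ℝ
  have h2 : a * x + b * y ≤ sin δ := by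
    refine le_of_sq_le_sq ?_ hS.le
    have e : (a * x + b * y) ^ 2 + (a * y - b * x) ^ 2 = (a ^ 2 + b ^ 2) * (x ^ 2 + y ^ 2) := by ring
    rw [hab] at e
    nlinarith [sq_nonneg (a * y - b * x), pow_le_pow_left₀ hC p0 2]
  exact ⟨h2, by nlinarith [mul_le_mul_of_nonneg_left h2 hC, mul_le_mul_of_nonneg_left p0 hS.le]⟩

/-! ### The thickness of a quarter of a disk -/

/-- The u, v coordinates are split into positive and negative parts p - n and q - l. Only p·l + n·q
enters negatively, and it is at most C because |n|² ≤ C²(1 - |p|²) and |l|² ≤ C²(1 - |q|²). -/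
theorem polar_scalars {C S k₀ p₁ p₂ n₁ n₂ m₀ q₁ q₂ l₁ l₂ : ℝ} (hC : 0 ≤ C)
    (hcs : S ^ 2 + C ^ 2 = 1) (hp₁ : 0 ≤ p₁) (hp₂ : 0 ≤ p₂) (hn₁ : 0 ≤ n₁) (hn₂ : 0 ≤ n₂)
    (hq₁ : 0 ≤ q₁) (hq₂ : 0 ≤ q₂) (hl₁ : 0 ≤ l₁) (hl₂ : 0 ≤ l₂) (hk₀ : 0 ≤ k₀) (hm₀ : 0 ≤ m₀)
    (hk : k₀ ^ 2 + (p₁ ^ 2 + p₂ ^ 2) + (n₁ ^ 2 + n₂ ^ 2) = 1)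
    (hm : m₀ ^ 2 + (q₁ ^ 2 + q₂ ^ 2) + (l₁ ^ 2 + l₂ ^ 2) = 1)
    (hkn : S ^ 2 * (n₁ ^ 2 + n₂ ^ 2) ≤ C ^ 2 * k₀ ^ 2)
    (hml : S ^ 2 * (l₁ ^ 2 + l₂ ^ 2) ≤ C ^ 2 * m₀ ^ 2) :
    -C ≤ k₀ * m₀ + (p₁ - n₁) * (q₁ - l₁) + (p₂ - n₂) * (q₂ - l₂) := by
  have a1 : n₁ ^ 2 + n₂ ^ 2 ≤ C ^ 2 * (1 - (p₁ ^ 2 + p₂ ^ 2)) := by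
    have : (n₁ ^ 2 + n₂ ^ 2) * (S ^ 2 + C ^ 2) ≤ C ^ 2 * (1 - (p₁ ^ 2 + p₂ ^ 2)) := by
      rw [← hk]; linarith
    rwa [hcs, mul_one] at this
  have a2 : l₁ ^ 2 + l₂ ^ 2 ≤ C ^ 2 * (1 - (q₁ ^ 2 + q₂ ^ 2)) := by
    have : (l₁ ^ 2 + l₂ ^ 2) * (S ^ 2 + C ^ 2) ≤ C ^ 2 * (1 - (q₁ ^ 2 + q₂ ^ 2)) := by
      rw [← hm]; linarith
    rwa [hcs, mul_one] at this
  have hX : p₁ * l₁ + p₂ * l₂ + n₁ * q₁ + n₂ * q₂ ≤ C := by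
    rcases eq_or_lt_of_le hC with h0 | h0
    · rw [← h0] at a1 a2 ⊢
      have e1 : n₁ = 0 := by nlinarith [sq_nonneg n₁, sq_nonneg n₂]
      have e2 : n₂ = 0 := by nlinarith [sq_nonneg n₁, sq_nonneg n₂]
      have e3 : l₁ = 0 := by nlinarith [sq_nonneg l₁, sq_nonneg l₂]
      have e4 : l₂ = 0 := by nlinarith [sq_nonneg l₁, sq_nonneg l₂]
      simp [e1, e2, e3, e4]
    · have : (2 * C) * (p₁ * l₁ + p₂ * l₂ + n₁ * q₁ + n₂ * q₂) ≤ (2 * C) * C := by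
        linarith [sq_nonneg (C * p₁ - l₁), sq_nonneg (C * p₂ - l₂), sq_nonneg (C * q₁ - n₁),
          sq_nonneg (C * q₂ - n₂)]
      exact le_of_mul_le_mul_left this (by positivity)
  have b0 := mul_nonneg hk₀ hm₀
  have b1 := mul_nonneg hp₁ hq₁
  have b2 := mul_nonneg hp₂ hq₂
  have b3 := mul_nonneg hn₁ hl₁
  have b4 := mul_nonneg hn₂ hl₂
  linarith

theorem IsFrame.polar_quarterDisk (h : IsFrame o u v) (h0 : 0 < δ) (h1 : δ ≤ π / 2) {k : S2}
    (hk : k ∈ polar (quarterDisk o u v δ)) :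
    0 ≤ ⟪(o : E3), k⟫_ℝ ∧ sin δ ^ 2 * (max (-⟪(u : E3), k⟫_ℝ) 0 ^ 2 + max (-⟪(v : E3), k⟫_ℝ) 0 ^ 2) ≤
      cos δ ^ 2 * ⟪(o : E3), k⟫_ℝ ^ 2 := by
  have hπ : δ ≤ π := by linarith [pi_pos]
  have hC : 0 ≤ cos δ := cos_nonneg_of_neg_pi_div_two_le_of_le (by linarith) h1
  have hS : 0 < sin δ := sin_pos_of_pos_of_lt_pi h0 (by linarith [pi_pos])
  have hcs := sin_sq_add_cos_sq δ
  have ho : o ∈ quarterDisk o u v δ := by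
    rw [mem_quarterDisk_iff h0.le hπ, inner_coe_self, h.uo, h.vo]
    exact ⟨cos_le_one δ, le_rfl, le_rfl⟩
  have hk0 : 0 ≤ ⟪(o : E3), k⟫_ℝ := by rw [real_inner_comm]; exact hk o ho
  refine ⟨hk0, ?_⟩
  set n := max (-⟪(u : E3), k⟫_ℝ) 0 with hn
  set l := max (-⟪(v : E3), k⟫_ℝ) 0 with hl
  have hn0 : 0 ≤ n := le_max_right _ _
  have hl0 : 0 ≤ l := le_max_right _ _
  have hnk : ⟪(u : E3), k⟫_ℝ * n = -n ^ 2 := by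
    rcases le_total 0 ⟪(u : E3), k⟫_ℝ with h' | h'
    · rw [hn, max_eq_right (by linarith)]; ring
    · rw [hn, max_eq_left (by linarith)]; ring
  have hlk : ⟪(v : E3), k⟫_ℝ * l = -l ^ 2 := by
    rcases le_total 0 ⟪(v : E3), k⟫_ℝ with h' | h'
    · rw [hl, max_eq_right (by linarith)]; ring
    · rw [hl, max_eq_left (by linarith)]; ring
  set N := √(n ^ 2 + l ^ 2) with hN
  have hN2 : N ^ 2 = n ^ 2 + l ^ 2 := sq_sqrt (by positivity)
  have key : sin δ * N ≤ cos δ * ⟪(o : E3), k⟫_ℝ := by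
    rcases eq_or_lt_of_le (sqrt_nonneg (n ^ 2 + l ^ 2)) with h' | h'
    · rw [hN, ← h']; simpa using mul_nonneg hC hk0
    · rw [← hN] at h'
      -- The arc point in the direction of the negative part of k, which gives the strongest
      -- condition on k.
      obtain ⟨p, hp, p0, p1, p2⟩ := h.exists_point (z := cos δ) (x := sin δ * (n / N))
        (y := sin δ * (l / N)) (by
          have : (n / N) ^ 2 + (l / N) ^ 2 = 1 := by
            rw [div_pow, div_pow, ← add_div, hN2, div_self]; rw [← hN2]; positivity
          linear_combination hcs + sin δ ^ 2 * this)
      have hpQ : p ∈ quarterDisk o u v δ := by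
        rw [mem_quarterDisk_iff h0.le hπ, p0, p1, p2]
        exact ⟨le_rfl, by positivity, by positivity⟩
      have := hk p hpQ
      rw [h.inner_eq, p0, p1, p2] at this
      have e : ⟪(u : E3), k⟫_ℝ * (sin δ * (n / N)) + ⟪(v : E3), k⟫_ℝ * (sin δ * (l / N)) =
          -(sin δ * N) := by
        have : ⟪(u : E3), k⟫_ℝ * (sin δ * (n / N)) + ⟪(v : E3), k⟫_ℝ * (sin δ * (l / N)) =
          sin δ * ((⟪(u : E3), k⟫_ℝ * n + ⟪(v : E3), k⟫_ℝ * l) / N) := by ring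
        rw [this, hnk, hlk, show -n ^ 2 + -l ^ 2 = -N ^ 2 by rw [hN2]; ring]
        field_simp
      linarith
  have := pow_le_pow_left₀ (by positivity) key 2
  rw [mul_pow, mul_pow, hN2] at this
  exact this

theorem IsFrame.thickness_quarterDisk (h : IsFrame o u v) (h0 : 0 < δ) (h1 : δ ≤ π / 2) :
    thickness (quarterDisk o u v δ) = δ := by
  have hπ : δ ≤ π := by linarith [pi_pos]
  have hC : 0 ≤ cos δ := cos_nonneg_of_neg_pi_div_two_le_of_le (by linarith) h1
  have hcs := sin_sq_add_cos_sq δ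
  -- The tangent hemisphere at the end of the arc in the direction u; with H(u) it bounds a lune of
  -- thickness δ.
  obtain ⟨m, -, m0, m1, m2⟩ := h.exists_point (z := sin δ) (x := -cos δ) (y := 0) (by linarith)
  refine (h.isConvexBody_quarterDisk h0 h1).thickness_eq h0.le hπ (k := u) (m := m) ?_ ?_ m1 ?_
  · exact fun p hp => ((mem_quarterDisk_iff h0.le hπ).1 hp).2.1
  · intro p hp
    rw [h.inner_eq, m0, m1, m2]
    have := (h.tangent_nonneg h0 h1 (a := 1) (b := 0) (by norm_num) hp).2
    linarith
  · intro k hk m hm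
    obtain ⟨k0, kn⟩ := h.polar_quarterDisk h0 h1 hk
    obtain ⟨m0, ml⟩ := h.polar_quarterDisk h0 h1 hm
    have hdec : ∀ t : ℝ, t = max t 0 - max (-t) 0 ∧ t ^ 2 = max t 0 ^ 2 + max (-t) 0 ^ 2 := by
      intro t
      rcases le_total 0 t with ht | ht
      · rw [max_eq_left ht, max_eq_right (by linarith)]; constructor <;> ring
      · rw [max_eq_right ht, max_eq_left (by linarith)]; constructor <;> ring
    have sk := h.sum_sq k
    have sm := h.sum_sq m
    rw [(hdec ⟪(u : E3), k⟫_ℝ).2, (hdec ⟪(v : E3), k⟫_ℝ).2] at sk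
    rw [(hdec ⟪(u : E3), m⟫_ℝ).2, (hdec ⟪(v : E3), m⟫_ℝ).2] at sm
    have := polar_scalars hC hcs (le_max_right ⟪(u : E3), k⟫_ℝ 0) (le_max_right ⟪(v : E3), k⟫_ℝ 0)
      (le_max_right _ _) (le_max_right _ _) (le_max_right ⟪(u : E3), m⟫_ℝ 0)
      (le_max_right ⟪(v : E3), m⟫_ℝ 0) (le_max_right _ _) (le_max_right _ _) k0 m0 (by linarith)
      (by linarith) kn ml
    rwa [← (hdec _).1, ← (hdec _).1, ← (hdec _).1, ← (hdec _).1, ← h.inner_eq] at this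

/-! ### Quarters of disks are reduced -/

theorem IsFrame.rotate (h : IsFrame o u v) : IsFrame u v o := ⟨h.uv, h.uo, h.vo⟩

theorem IsFrame.add_pos_of_ne (h : IsFrame o u v) {p : S2} (h0 : 0 ≤ ⟪(o : E3), p⟫_ℝ)
    (h1 : 0 ≤ ⟪(u : E3), p⟫_ℝ) (h2 : 0 ≤ ⟪(v : E3), p⟫_ℝ) (hne : o ≠ p) :
    0 < ⟪(u : E3), p⟫_ℝ + ⟪(v : E3), p⟫_ℝ := by
  by_contra! hle
  have e1 : ⟪(u : E3), p⟫_ℝ = 0 := by linarith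
  have e2 : ⟪(v : E3), p⟫_ℝ = 0 := by linarith
  have e3 := h.sum_sq p
  rw [e1, e2] at e3
  exact hne (inner_coe_eq_one.1 (by nlinarith))

/-- The tangent great circle of the disk touches the quarter only at the point of tangency. -/
theorem IsFrame.tangent_pos (h : IsFrame o u v) (h0 : 0 < δ) (h1 : δ < π / 2) {a b : ℝ}
    (hab : a ^ 2 + b ^ 2 = 1) {p w : S2} (hp : p ∈ quarterDisk o u v δ)
    (w0 : ⟪(o : E3), w⟫_ℝ = cos δ) (w1 : ⟪(u : E3), w⟫_ℝ = sin δ * a)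
    (w2 : ⟪(v : E3), w⟫_ℝ = sin δ * b) (hne : p ≠ w) :
    0 < sin δ * ⟪(o : E3), p⟫_ℝ - cos δ * (a * ⟪(u : E3), p⟫_ℝ + b * ⟪(v : E3), p⟫_ℝ) := by
  have hC : 0 < cos δ := cos_pos_of_mem_Ioo ⟨by linarith, h1⟩
  have hS : 0 < sin δ := sin_pos_of_pos_of_lt_pi h0 (by linarith [pi_pos])
  have hcs := sin_sq_add_cos_sq δ
  obtain ⟨t1, t2⟩ := h.tangent_nonneg h0 h1.le hab hp
  obtain ⟨q0, -, -⟩ := (mem_quarterDisk_iff h0.le (by linarith [pi_pos])).1 hp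
  have hsp := h.sum_sq p
  by_contra! hle
  refine hne (h.ext ?_ ?_ ?_)
  all_goals
    set z := ⟪(o : E3), p⟫_ℝ
    set x := ⟪(u : E3), p⟫_ℝ
    set y := ⟪(v : E3), p⟫_ℝ
    have e1 : z = cos δ := by
      refine le_antisymm (le_of_mul_le_mul_left ?_ hS) q0
      linarith [mul_le_mul_of_nonneg_left t1 hC.le]
    have e2 : a * x + b * y = sin δ := by
      refine le_antisymm t1 (le_of_mul_le_mul_left ?_ hC)
      rw [e1] at hle
      linarith
    rw [e1] at hsp
    have e3 : (x - sin δ * a) ^ 2 + (y - sin δ * b) ^ 2 = 0 := by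
      linear_combination hsp - hcs + sin δ ^ 2 * hab - 2 * sin δ * e2
    have s1 := sq_nonneg (x - sin δ * a)
    have s2 := sq_nonneg (y - sin δ * b)
  · rw [e1, w0]
  · rw [w1, ← sub_eq_zero]
    exact (pow_eq_zero_iff two_ne_zero).1 (by linarith)
  · rw [w2, ← sub_eq_zero]
    exact (pow_eq_zero_iff two_ne_zero).1 (by linarith)

theorem IsConvexBody.neg_cos_lt_of_le_thickness {Z : Set S2} (hZ : IsConvexBody Z) (h0 : 0 ≤ δ)
    (hth : δ ≤ thickness Z) {k m : S2} (hk : ∀ p ∈ Z, 0 < ⟪(k : E3), p⟫_ℝ) (hm : m ∈ polar Z) :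
    -cos δ < ⟪(k : E3), m⟫_ℝ := by
  obtain ⟨-, h3, -, -⟩ := hZ.exists_diametral
  have := cos_le_cos_of_nonneg_of_le_pi h0 h3.le hth
  linarith [hZ.neg_cos_thickness_lt hk hm]

theorem inv_sqrt_two_sq : ((√2)⁻¹) ^ 2 = (1 / 2 : ℝ) := by
  rw [inv_pow, sq_sqrt (by norm_num)]; norm_num

/-- A body in a quarter of a disk that is at least as thick contains the center of the disk. -/
theorem IsFrame.center_mem_of_le_thickness (h : IsFrame o u v) (h0 : 0 < δ) (h1 : δ ≤ π / 2)
    {Z : Set S2} (hZ : IsConvexBody Z) (hsub : Z ⊆ quarterDisk o u v δ) (hth : δ ≤ thickness Z) :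
    o ∈ Z := by
  by_contra ho
  have hC : 0 ≤ cos δ := cos_nonneg_of_neg_pi_div_two_le_of_le (by linarith) h1
  have hr : 0 < (√2)⁻¹ := by positivity
  have hr2 := inv_sqrt_two_sq
  -- H(k) touches the quarter only at o, and with the tangent hemisphere H(m) at the midpoint of the
  -- arc it bounds a lune of thickness δ. If o is not in Z, then Z is interior to H(k), hence too
  -- thin.
  obtain ⟨k, -, k0, k1, k2⟩ := h.exists_point (z := 0) (x := (√2)⁻¹) (y := (√2)⁻¹) (by linarith)
  obtain ⟨m, -, m0, m1, m2⟩ := h.exists_point (z := sin δ) (x := -(cos δ * (√2)⁻¹))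
    (y := -(cos δ * (√2)⁻¹)) (by rw [neg_sq, mul_pow, hr2]; linarith [sin_sq_add_cos_sq δ])
  refine absurd (hZ.neg_cos_lt_of_le_thickness h0.le hth (k := k) (m := m) (fun p hp => ?_)
    (fun p hp => ?_)) ?_
  · obtain ⟨q0, q1, q2⟩ := (mem_quarterDisk_iff h0.le (by linarith [pi_pos])).1 (hsub hp)
    have := mul_pos hr (h.add_pos_of_ne (hC.trans q0) q1 q2 fun e => ho (e ▸ hp))
    rw [h.inner_eq, k0, k1, k2]
    linarith
  · have := (h.tangent_nonneg h0 h1 (a := (√2)⁻¹) (b := (√2)⁻¹) (by linarith) (hsub hp)).2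
    rw [h.inner_eq, m0, m1, m2]
    linarith
  · rw [h.inner_eq, k0, k1, k2, m0, m1, m2, not_lt]
    have : (√2)⁻¹ * (-(cos δ * (√2)⁻¹)) = -(cos δ * ((√2)⁻¹) ^ 2) := by ring
    rw [this, hr2]
    linarith

/-- A body of thickness at least `π / 2` in an octant contains its vertices. -/
theorem IsFrame.vertex_mem_of_le_thickness (h : IsFrame o u v) {Z : Set S2} (hZ : IsConvexBody Z)
    (ho : ∀ p ∈ Z, 0 ≤ ⟪(o : E3), p⟫_ℝ) (hu : ∀ p ∈ Z, 0 ≤ ⟪(u : E3), p⟫_ℝ)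
    (hv : ∀ p ∈ Z, 0 ≤ ⟪(v : E3), p⟫_ℝ) (hth : π / 2 ≤ thickness Z) : o ∈ Z := by
  by_contra hne
  have hr : 0 < (√2)⁻¹ := by positivity
  obtain ⟨k, -, k0, k1, k2⟩ := h.exists_point (z := 0) (x := (√2)⁻¹) (y := (√2)⁻¹)
    (by linarith [inv_sqrt_two_sq])
  refine absurd (hZ.neg_cos_lt_of_le_thickness (by positivity) hth (k := k) (m := o)
    (fun p hp => ?_) ho) ?_
  · have := mul_pos hr (h.add_pos_of_ne (ho p hp) (hu p hp) (hv p hp) fun e => hne (e ▸ hp))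
    rw [h.inner_eq, k0, k1, k2]
    linarith
  · rw [real_inner_comm, k0, cos_pi_div_two]; norm_num

/-- A body in a quarter of a disk that is at least as thick contains the bounding circular arc. -/
theorem IsFrame.arc_mem_of_le_thickness (h : IsFrame o u v) (h0 : 0 < δ) (h1 : δ ≤ π / 2)
    {Z : Set S2} (hZ : IsConvexBody Z) (hsub : Z ⊆ quarterDisk o u v δ) (hth : δ ≤ thickness Z)
    {a b : ℝ} (ha : 0 ≤ a) (hb : 0 ≤ b) (hab : a ^ 2 + b ^ 2 = 1) {w : S2}
    (hw : (w : E3) = cos δ • (o : E3) + (sin δ * a) • (u : E3) + (sin δ * b) • (v : E3)) :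
    w ∈ Z := by
  have hcs := sin_sq_add_cos_sq δ
  have hQ : ∀ p ∈ Z, cos δ ≤ ⟪(o : E3), p⟫_ℝ ∧ 0 ≤ ⟪(u : E3), p⟫_ℝ ∧ 0 ≤ ⟪(v : E3), p⟫_ℝ :=
    fun p hp => (mem_quarterDisk_iff h0.le (by linarith [pi_pos])).1 (hsub hp)
  -- For δ = π/2 the arc lies on a great circle, so no tangent isolates its points; its two ends and
  -- convexity are used instead.
  rcases eq_or_lt_of_le h1 with rfl | hlt
  · rw [cos_pi_div_two] at hQ
    have huZ : u ∈ Z := h.rotate.vertex_mem_of_le_thickness hZ (fun p hp => (hQ p hp).2.1)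
      (fun p hp => (hQ p hp).2.2) (fun p hp => (hQ p hp).1) hth
    have hvZ : v ∈ Z := h.rotate.rotate.vertex_mem_of_le_thickness hZ (fun p hp => (hQ p hp).2.2)
      (fun p hp => (hQ p hp).1) (fun p hp => (hQ p hp).2.1) hth
    refine hZ.2.1.2 u huZ v hvZ ⟨a, b, ha, hb, ?_⟩
    rw [hw, cos_pi_div_two, sin_pi_div_two, zero_smul, zero_add, one_mul, one_mul]
  · by_contra hwZ
    obtain ⟨w', hw', w0, w1, w2⟩ := h.exists_point (z := cos δ) (x := sin δ * a) (y := sin δ * b)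
      (by linear_combination hcs + sin δ ^ 2 * hab)
    obtain rfl : w = w' := Subtype.ext (hw.trans hw'.symm)
    obtain ⟨k, -, k0, k1, k2⟩ := h.exists_point (z := sin δ) (x := -(cos δ * a))
      (y := -(cos δ * b)) (by linear_combination hcs + cos δ ^ 2 * hab)
    obtain ⟨m, -, m0, m1, m2⟩ := h.exists_point (z := 0) (x := a) (y := b) (by linarith)
    refine absurd (hZ.neg_cos_lt_of_le_thickness h0.le hth (k := k) (m := m) (fun p hp => ?_)
      (fun p hp => ?_)) ?_
    · have := h.tangent_pos h0 hlt hab (hsub hp) w0 w1 w2 fun e => hwZ (e ▸ hp)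
      rw [h.inner_eq, k0, k1, k2]
      linarith
    · rw [h.inner_eq, m0, m1, m2]
      have := mul_nonneg ha (hQ p hp).2.1
      have := mul_nonneg hb (hQ p hp).2.2
      linarith
    · rw [h.inner_eq, k0, k1, k2, m0, m1, m2, not_lt]
      have : sin δ * 0 + -(cos δ * a) * a + -(cos δ * b) * b = -(cos δ * (a ^ 2 + b ^ 2)) := by ring
      rw [this, hab, mul_one]

theorem IsFrame.isReduced_quarterDisk (h : IsFrame o u v) (h0 : 0 < δ) (h1 : δ ≤ π / 2) :
    IsReduced (quarterDisk o u v δ) := by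
  refine ⟨h.isConvexBody_quarterDisk h0 h1, fun Z hZ hsub hne => ?_⟩
  rw [h.thickness_quarterDisk h0 h1]
  by_contra! hth
  refine hne (Subset.antisymm hsub ?_)
  have hπ : δ ≤ π := by linarith [pi_pos]
  have hC : 0 ≤ cos δ := cos_nonneg_of_neg_pi_div_two_le_of_le (by linarith) h1
  have hS : 0 < sin δ := sin_pos_of_pos_of_lt_pi h0 (by linarith [pi_pos])
  have hcs := sin_sq_add_cos_sq δ
  have hoZ := h.center_mem_of_le_thickness h0 h1 hZ hsub hth
  intro p hp
  obtain ⟨p0, p1, p2⟩ := (mem_quarterDisk_iff h0.le hπ).1 hp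
  have hsp := h.sum_sq p
  have hexp := h.expand p
  set z := ⟪(o : E3), p⟫_ℝ
  set x := ⟪(u : E3), p⟫_ℝ
  set y := ⟪(v : E3), p⟫_ℝ
  set r := √(x ^ 2 + y ^ 2) with hrd
  have hr2 : r ^ 2 = x ^ 2 + y ^ 2 := sq_sqrt (by positivity)
  rcases eq_or_lt_of_le (sqrt_nonneg (x ^ 2 + y ^ 2)) with hr0 | hrpos
  · rw [← hrd] at hr0
    rw [← hr0] at hr2
    have hz : ⟪(o : E3), p⟫_ℝ = 1 := by
      change z = 1
      nlinarith
    exact inner_coe_eq_one.1 hz ▸ hoZ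
  · rw [← hrd] at hrpos
    have hab : (x / r) ^ 2 + (y / r) ^ 2 = 1 := by
      rw [div_pow, div_pow, ← add_div, ← hr2, div_self (by positivity)]
    obtain ⟨w, hw, -, -, -⟩ := h.exists_point (z := cos δ) (x := sin δ * (x / r))
      (y := sin δ * (y / r)) (by linear_combination hcs + sin δ ^ 2 * hab)
    have hwZ := h.arc_mem_of_le_thickness h0 h1 hZ hsub hth (by positivity) (by positivity) hab hw
    have hrS : r ≤ sin δ := by
      refine le_of_sq_le_sq ?_ hS.le
      nlinarith [pow_le_pow_left₀ hC p0 2]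
    refine hZ.2.1.2 o hoZ w hwZ ⟨z - cos δ * (r / sin δ), r / sin δ, ?_, by positivity, ?_⟩
    · have : r / sin δ ≤ 1 := by rw [div_le_one hS]; exact hrS
      nlinarith
    · rw [hw]
      conv_lhs => rw [hexp]
      match_scalars
      · ring
      · field_simp
      · field_simp

/-! ### Optimality of the radius -/

theorem IsFrame.le_of_quarterDisk_subset_disk (h : IsFrame o u v) (h0 : 0 < δ) (h1 : δ ≤ π / 2)
    {c : S2} {ρ : ℝ} (hsub : quarterDisk o u v δ ⊆ disk c ρ) :
    arctan (√2 * tan (δ / 2)) ≤ ρ := by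
  have hπ : δ ≤ π := by linarith [pi_pos]
  have hC : 0 ≤ cos δ := cos_nonneg_of_neg_pi_div_two_le_of_le (by linarith) h1
  have hS : 0 < sin δ := sin_pos_of_pos_of_lt_pi h0 (by linarith [pi_pos])
  have hcs := sin_sq_add_cos_sq δ
  rcases le_or_gt (π / 2) ρ with hρ | hρ
  · exact (arctan_lt_pi_div_two _).le.trans hρ
  have ho : o ∈ quarterDisk o u v δ := by
    rw [mem_quarterDisk_iff h0.le hπ, inner_coe_self, h.uo, h.vo]
    exact ⟨cos_le_one δ, le_rfl, le_rfl⟩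
  have hρ0 : 0 ≤ ρ := (InnerProductGeometry.angle_nonneg _ _).trans (hsub ho)
  have hρπ : ρ ≤ π := by linarith
  have hcρ : 0 ≤ cos ρ := cos_nonneg_of_neg_pi_div_two_le_of_le (by linarith) hρ.le
  obtain ⟨p, -, p0, p1, p2⟩ := h.exists_point (z := cos δ) (x := sin δ) (y := 0) (by linarith)
  obtain ⟨q, -, q0, q1, q2⟩ := h.exists_point (z := cos δ) (x := 0) (y := sin δ) (by linarith)
  have hp : p ∈ quarterDisk o u v δ := by
    rw [mem_quarterDisk_iff h0.le hπ, p0, p1, p2]; exact ⟨le_rfl, hS.le, le_rfl⟩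
  have hq : q ∈ quarterDisk o u v δ := by
    rw [mem_quarterDisk_iff h0.le hπ, q0, q1, q2]; exact ⟨le_rfl, le_rfl, hS.le⟩
  have i0 := (mem_disk_iff hρ0 hρπ).1 (hsub ho)
  have i1 := (mem_disk_iff hρ0 hρπ).1 (hsub hp)
  have i2 := (mem_disk_iff hρ0 hρπ).1 (hsub hq)
  rw [h.inner_eq, inner_coe_self, h.uo, h.vo] at i0
  rw [h.inner_eq, p0, p1, p2] at i1
  rw [h.inner_eq, q0, q1, q2] at i2
  have hc := h.sum_sq c
  have hC1 : cos δ ≤ 1 := cos_le_one δ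
  set C := cos δ with hCd
  set S := sin δ
  set z := ⟪(o : E3), c⟫_ℝ
  set x := ⟪(u : E3), c⟫_ℝ
  set y := ⟪(v : E3), c⟫_ℝ
  -- The center o and the arc ends p, q get the weights 1 - C, 1, 1. The weighted sum has
  -- coordinates (1 + C, S, S) and squared norm (1 + C)(3 - C), so Cauchy–Schwarz against c is sharp
  -- for the circumcenter.
  have hsumle : (3 - C) * cos ρ ≤ (1 + C) * z + S * x + S * y := by
    have := mul_le_mul_of_nonneg_left i0 (by linarith : 0 ≤ 1 - C)
    linarith
  have hcauchy : ((1 + C) * z + S * x + S * y) ^ 2 ≤ (1 + C) * (3 - C) := by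
    have e : ((1 + C) * z + S * x + S * y) ^ 2 + ((1 + C) * x - S * z) ^ 2 +
        ((1 + C) * y - S * z) ^ 2 + (S * x - S * y) ^ 2 =
        ((1 + C) ^ 2 + 2 * S ^ 2) * (z ^ 2 + x ^ 2 + y ^ 2) := by ring
    rw [hc, show S ^ 2 = 1 - C ^ 2 by linarith] at e
    linarith [sq_nonneg ((1 + C) * x - S * z), sq_nonneg ((1 + C) * y - S * z),
      sq_nonneg (S * x - S * y)]
  have hκ : cos ρ ^ 2 ≤ cos (arctan (√2 * tan (δ / 2))) ^ 2 := by
    have h3 : 0 < 3 - C := by linarith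
    rw [cos_sq_arctan_radius h0 h1, ← hCd, le_div_iff₀ h3]
    have h4 := (pow_le_pow_left₀ (by positivity) hsumle 2).trans hcauchy
    refine le_of_mul_le_mul_left ?_ h3
    linarith
  have hle : cos ρ ≤ cos (arctan (√2 * tan (δ / 2))) :=
    le_of_sq_le_sq hκ (cos_arctan_pos _).le
  by_contra! hlt
  have := cos_lt_cos_of_nonneg_of_le_pi hρ0
    (by linarith [arctan_lt_pi_div_two (√2 * tan (δ / 2))]) hlt
  linarith

end Frame

end Spherical

theorem mainTheorem1 :
    (∀ R : Set Spherical.S2, Spherical.IsReduced R →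
      Spherical.thickness R ≤ Real.pi / 2 →
      ∃ c : Spherical.S2,
        R ⊆ Spherical.disk c
          (Real.arctan (Real.sqrt 2 * Real.tan (Spherical.thickness R / 2)))) ∧
    (∀ δ : ℝ, 0 < δ → δ ≤ Real.pi / 2 →
      ∀ o u v : Spherical.S2,
        Spherical.sdist o u = Real.pi / 2 → Spherical.sdist o v = Real.pi / 2 →
        Spherical.sdist u v = Real.pi / 2 →
        Spherical.IsReduced (Spherical.quarterDisk o u v δ) ∧
        Spherical.thickness (Spherical.quarterDisk o u v δ) = δ ∧
        ∀ (c : Spherical.S2) (ρ : ℝ),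
          Spherical.quarterDisk o u v δ ⊆ Spherical.disk c ρ →
          Real.arctan (Real.sqrt 2 * Real.tan (δ / 2)) ≤ ρ) := by
  refine ⟨fun R hR hle => hR.exists_covering_disk hle, fun δ h0 h1 o u v hou hov huv => ?_⟩
  have h := Spherical.IsFrame.of_sdist hou hov huv
  exact ⟨h.isReduced_quarterDisk h0 h1, h.thickness_quarterDisk h0 h1,
    fun c ρ hsub => h.le_of_quarterDisk_subset_disk h0 h1 hsub⟩
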